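/- Let $d\ge 1$ and let $f:[0,\infty)\to[0,\infty)$ be continuous and non-decreasing. Consider $$u_t-\Delta u=f(u)\quad\text{on }\mathbb{R}^d,\qquad u(0)=u_0\ge 0. \tag{1}$$ For $t>0$ let $S(t)$ denote the heat semigroup, $[S(t)g](x)=\int_{\mathbb{R}^d}(4\pi t)^{-d/2}e^{-|x-y|^2/4t}g(y)\,dy$, and let $S(0)$ be the identity. A function $u:\mathbb{R}^d\times[0,T)\to[0,\infty]$ is a *local integral solution* of (1) on $[0,T)$ if it is measurable, finite almost everywhere, and satisfies $$u(t)=S(t)u_0+\int_0^tS(t-s)f(u(s))\,ds$$ almost everywhere in $\mathbb{R}^d\times[0,T)$. For $q\in[1,\infty)$, a *local $L^q$ solution* is a function $u$ that for some $T>0$ is a local integral solution on $[0,T)$ and satisfies $u\in L^\infty((0,T);L^q(\mathbb{R}^d))$. Equation (1) has the *local $L^q$ existence property* if for every non-negative $u_0\in L^q(\mathbb{R}^d)$ there is a local $L^q$ solution. Then: (i) for every $q\in(1,\infty)$, equation (1) has the local $L^q$ existence property if and only if $$\limsup_{s\to0^+}\frac{f(s)}{s}<\infty\quad\text{and}\quad\limsup_{s\to\infty}s^{-(1+2q/d)}f(s)<\infty;$$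 (ii) equation (1) has the local $L^1$ existence property if and only if $$\limsup_{s\to0^+}\frac{f(s)}{s}<\infty\quad\text{and}\quad\int_1^\infty s^{-(1+2/d)}F(s)\,ds<\infty,\qquad\text{where } F(s)=\sup_{0<t\le s}\frac{f(t)}{t}.$$ -/

import Mathlib

open MeasureTheory Filter Set Topology
open scoped NNReal ENNReal

noncomputable section

/-- The Gaussian heat kernel `(4πt)^{-d/2} exp (-|z|²/(4t))` on `ℝ^d`, for `t > 0`. -/
def heatKernel {d : ℕ} (t : ℝ) (z : EuclideanSpace ℝ (Fin d)) : ℝ :=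
  (4 * Real.pi * t) ^ (-((d : ℝ) / 2)) * Real.exp (-(‖z‖ ^ 2) / (4 * t))

/-- The heat semigroup `S(t)` on `ℝ^d`, acting on non-negative (possibly infinite) functions:
convolution with the Gaussian kernel for `t > 0`, and the identity at `t = 0`.
Only `t ≥ 0` is meaningful. -/
def heatSemigroup {d : ℕ} (t : ℝ) (g : EuclideanSpace ℝ (Fin d) → ℝ≥0∞)
    (x : EuclideanSpace ℝ (Fin d)) : ℝ≥0∞ :=
  if 0 < t then ∫⁻ y, ENNReal.ofReal (heatKernel t (x - y)) * g y else g x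

/-- `u` is a local integral solution on `[0,T)` of `u_t - Δu = f(u)`, `u(0) = u₀`, on `ℝ^d`:
it is (Lebesgue) measurable with values in `[0,∞]`, finite a.e., and satisfies
`u(t) = S(t)u₀ + ∫₀ᵗ S(t-s) f(u(s)) ds` a.e. in `ℝ^d × [0,T)`.
The value that `toNNReal` gives to `f(∞)` is irrelevant, as `u` is finite a.e. -/
structure IsLocalIntegralSolution {d : ℕ} (f : ℝ≥0 → ℝ≥0)
    (u₀ : EuclideanSpace ℝ (Fin d) → ℝ) (T : ℝ)
    (u : EuclideanSpace ℝ (Fin d) × ℝ → ℝ≥0∞) : Prop where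
  aemeasurable : AEMeasurable u (volume.restrict (univ ×ˢ Ico 0 T))
  finite_ae : ∀ᵐ z ∂(volume.restrict (univ ×ˢ Ico 0 T)), u z < ⊤
  eq_ae : ∀ᵐ z ∂(volume.restrict (univ ×ˢ Ico 0 T)),
    u z = heatSemigroup z.2 (fun y => ENNReal.ofReal (u₀ y)) z.1 +
      ∫⁻ s in Ioo 0 z.2, heatSemigroup (z.2 - s) (fun y => (f (u (y, s)).toNNReal : ℝ≥0∞)) z.1

/-- A local `L^q` solution: a local integral solution on some `[0,T)`, `T > 0`, that belongs to
`L^∞((0,T); L^q(ℝ^d))`. -/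
def IsLocalLqSolution {d : ℕ} (f : ℝ≥0 → ℝ≥0) (q : ℝ≥0∞)
    (u₀ : EuclideanSpace ℝ (Fin d) → ℝ)
    (u : EuclideanSpace ℝ (Fin d) × ℝ → ℝ≥0∞) : Prop :=
  ∃ T : ℝ, 0 < T ∧ IsLocalIntegralSolution f u₀ T u ∧
    essSup (fun t => eLpNorm (fun x => u (x, t)) q volume) (volume.restrict (Ioo 0 T)) < ⊤

/-- The local existence property in `L^q(ℝ^d)`: every non-negative `u₀ ∈ L^q(ℝ^d)` gives rise to
a local `L^q` solution. -/
def HasLocalExistenceProperty (d : ℕ) (f : ℝ≥0 → ℝ≥0) (q : ℝ≥0∞) : Prop :=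
  ∀ u₀ : EuclideanSpace ℝ (Fin d) → ℝ, MemLp u₀ q volume → 0 ≤ᵐ[volume] u₀ →
    ∃ u : EuclideanSpace ℝ (Fin d) × ℝ → ℝ≥0∞, IsLocalLqSolution f q u₀ u

/-- `F(s) = sup_{0 < t ≤ s} f(t)/t`, with values in `[0,∞]`. -/
def supQuotient (f : ℝ≥0 → ℝ≥0) (s : ℝ≥0) : ℝ≥0∞ :=
  ⨆ t ∈ Ioc 0 s, (f t : ℝ≥0∞) / (t : ℝ≥0∞)

end

/-! ### The heat kernel -/

/-! Existence is a comparison argument. As `f` is non-decreasing, iterating the Duhamel map from 0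
stays below any finite supersolution and increases to a solution
(`isLocalLqSolution_of_supersolution`), so it suffices to find a supersolution `w` bounded in `L^q`.

For `q > 1` the hypotheses give `f a ≤ C (a + a ^ p)` with the critical exponent `p = 1 + 2q/d`.
Take `1 < r < min q p`, `φ = U ^ r` and `w = 2 (S(t)φ)^(1/r)`. By Jensen, `S(t)U ≤ w(t)/2` and
`S(t-s)w(s) ≤ w(t)`. The superlinear term is a multiple of `(S(s)φ)^(p/r-1)` times `S(s)φ`: the
first factor is bounded by smoothing, the second is carried to time `t` exactly by the semigroup
law. At the critical exponent all powers of `t` cancel, so smallness comes from the constant: for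
data in `L^m` the smoothing estimate holds with `o(t^(-d/(2m)))`
(`exists_heatSemigroup_le_mul_rpow`). For `q = 1` no such `r` exists; there `w = 2 S(t)U ≤ A
t^(-d/2)` gives `f(w) ≤ F(A t^(-d/2)) w`, and integrability of `F(A s^(-d/2))` at `s = 0` is the
integral condition after a change of variable.

Necessity tests the equation on superpositions of functions of height `s_k` on balls of radius `r_k`
about 0. Up to time `r²` the heat flow keeps a fixed fraction `c` of the height on the ball, so a
solution has `L^q` norm at least of order `τ f(c s) r^(d/q)` for `τ < r²`; if either limsup is
infinite, this is unbounded along a choice with `∑ s_k^q r_k^d < ∞`. For the integral condition the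
times after `r²` matter: a bump of mass `m` is then at least `c m σ^(-d/2)` on `|x| < √σ`, and by
conservation of mass the `L¹` norm dominates `∫ f(c m σ^(-d/2)) σ^(d/2) dσ`. A Hardy-type inequality
(`lintegral_supQuotient_lt_top`) shows that this diverges when the integral of `F` does, however
small `m` is. -/

theorem heatKernel_nonneg {d : ℕ} {t : ℝ} (ht : 0 < t) (z : EuclideanSpace ℝ (Fin d)) :
    0 ≤ heatKernel t z := by
  unfold heatKernel
  positivity

theorem heatKernel_le {d : ℕ} {t : ℝ} (ht : 0 < t) (z : EuclideanSpace ℝ (Fin d)) :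
    heatKernel t z ≤ (4 * Real.pi * t) ^ (-((d : ℝ) / 2)) := by
  unfold heatKernel
  refine mul_le_of_le_one_right (by positivity) (Real.exp_le_one_iff.2 ?_)
  rw [neg_div]
  exact neg_nonpos.2 (by positivity)

theorem measurable_heatKernel {d : ℕ} :
    Measurable fun p : ℝ × EuclideanSpace ℝ (Fin d) => heatKernel p.1 p.2 := by
  unfold heatKernel
  fun_prop

theorem integral_heatKernel {d : ℕ} {t : ℝ} (ht : 0 < t) :
    ∫ z : EuclideanSpace ℝ (Fin d), heatKernel t z = 1 := by
  unfold heatKernel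
  have h := GaussianFourier.integral_rexp_neg_mul_sq_norm
    (V := EuclideanSpace ℝ (Fin d)) (b := 1 / (4 * t)) (by positivity)
  rw [integral_const_mul]
  have e : ∀ v : EuclideanSpace ℝ (Fin d), -‖v‖ ^ 2 / (4 * t) = -(1 / (4 * t)) * ‖v‖ ^ 2 := by
    intro v
    ring
  simp_rw [e, h]
  rw [finrank_euclideanSpace_fin, show Real.pi / (1 / (4 * t)) = 4 * Real.pi * t by
    field_simp, ← Real.rpow_add (by positivity)]
  simp

theorem lintegral_heatKernel_sub {d : ℕ} {t : ℝ} (ht : 0 < t) (x : EuclideanSpace ℝ (Fin d)) :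
    ∫⁻ y, ENNReal.ofReal (heatKernel t (x - y)) = 1 := by
  rw [lintegral_sub_left_eq_self (fun z => ENNReal.ofReal (heatKernel t z)) x,
    ← ofReal_integral_eq_lintegral_ofReal
      (integrable_of_integral_eq_one (integral_heatKernel ht))
      (ae_of_all _ (heatKernel_nonneg ht)), integral_heatKernel ht, ENNReal.ofReal_one]

theorem heatKernel_neg {d : ℕ} (t : ℝ) (z : EuclideanSpace ℝ (Fin d)) :
    heatKernel t (-z) = heatKernel t z := by
  simp [heatKernel]

/-- Completing the square in a product of two heat kernels. -/
theorem heatKernel_mul_heatKernel {d : ℕ} {t s : ℝ} (ht : 0 < t) (hs : 0 < s)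
    (x y z : EuclideanSpace ℝ (Fin d)) :
    heatKernel t (x - y) * heatKernel s (y - z) =
      heatKernel (t + s) (x - z) *
        heatKernel (t * s / (t + s)) ((s / (t + s)) • x + (t / (t + s)) • z - y) := by
  unfold heatKernel
  have hts : 0 < t + s := by positivity
  have hc : (4 * Real.pi * t) ^ (-((d : ℝ) / 2)) * (4 * Real.pi * s) ^ (-((d : ℝ) / 2)) =
      (4 * Real.pi * (t + s)) ^ (-((d : ℝ) / 2)) *
        (4 * Real.pi * (t * s / (t + s))) ^ (-((d : ℝ) / 2)) := by
    rw [← Real.mul_rpow (by positivity) (by positivity),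
      ← Real.mul_rpow (by positivity) (by positivity)]
    congr 1
    field_simp
  -- For weights `a + b = 1`: `|a v - b w|² = a|v|² + b|w|² - ab|v + w|²`, with `v = x - y` and `w =
  -- y - z`.
  have hn : ‖(s / (t + s)) • x + (t / (t + s)) • z - y‖ ^ 2 =
      (s / (t + s)) * ‖x - y‖ ^ 2 + (t / (t + s)) * ‖y - z‖ ^ 2
        - (s / (t + s)) * (t / (t + s)) * ‖x - z‖ ^ 2 := by
    have h1 : (s / (t + s)) • x + (t / (t + s)) • z - y =
        (s / (t + s)) • (x - y) - (t / (t + s)) • (y - z) := by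
      have : (s / (t + s)) + (t / (t + s)) = 1 := by field_simp; ring
      calc _ = (s / (t + s)) • x + (t / (t + s)) • z - ((s / (t + s)) + (t / (t + s))) • y := by
            rw [this, one_smul]
        _ = _ := by module
    have h2 : x - z = (x - y) + (y - z) := by abel
    rw [h1, h2, norm_sub_sq_real, norm_add_sq_real, norm_smul, norm_smul, inner_smul_left,
      inner_smul_right, Real.norm_of_nonneg (by positivity), Real.norm_of_nonneg (by positivity)]
    simp only [conj_trivial]
    field_simp
    ring
  have he : -‖x - y‖ ^ 2 / (4 * t) + -‖y - z‖ ^ 2 / (4 * s) =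
      -‖x - z‖ ^ 2 / (4 * (t + s)) +
        -‖(s / (t + s)) • x + (t / (t + s)) • z - y‖ ^ 2 / (4 * (t * s / (t + s))) := by
    rw [hn]
    field_simp
    ring
  calc _ = ((4 * Real.pi * t) ^ (-((d : ℝ) / 2)) * (4 * Real.pi * s) ^ (-((d : ℝ) / 2))) *
        (Real.exp (-‖x - y‖ ^ 2 / (4 * t)) * Real.exp (-‖y - z‖ ^ 2 / (4 * s))) := by ring
    _ = _ := by
      rw [hc, ← Real.exp_add, he, Real.exp_add]
      ring

/-- After completing the square, the only factor depending on `y` is a heat kernel of total mass 1.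
-/
theorem lintegral_heatKernel_mul_heatKernel {d : ℕ} {t s : ℝ} (ht : 0 < t) (hs : 0 < s)
    (x z : EuclideanSpace ℝ (Fin d)) :
    ∫⁻ y, ENNReal.ofReal (heatKernel t (x - y)) * ENNReal.ofReal (heatKernel s (y - z)) =
      ENNReal.ofReal (heatKernel (t + s) (x - z)) := by
  have hts : 0 < t + s := by positivity
  simp_rw [← ENNReal.ofReal_mul (heatKernel_nonneg ht _), heatKernel_mul_heatKernel ht hs,
    ENNReal.ofReal_mul (heatKernel_nonneg hts _)]
  rw [lintegral_const_mul' _ _ ENNReal.ofReal_ne_top,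
    lintegral_heatKernel_sub (by positivity), mul_one]

/-! ### The heat semigroup -/

theorem heatSemigroup_of_pos {d : ℕ} {t : ℝ} (ht : 0 < t)
    (g : EuclideanSpace ℝ (Fin d) → ℝ≥0∞) (x : EuclideanSpace ℝ (Fin d)) :
    heatSemigroup t g x = ∫⁻ y, ENNReal.ofReal (heatKernel t (x - y)) * g y :=
  if_pos ht

theorem heatSemigroup_congr_ae {d : ℕ} {t : ℝ} (ht : 0 < t)
    {g h : EuclideanSpace ℝ (Fin d) → ℝ≥0∞} (hgh : g =ᵐ[volume] h)
    (x : EuclideanSpace ℝ (Fin d)) : heatSemigroup t g x = heatSemigroup t h x := by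
  rw [heatSemigroup_of_pos ht, heatSemigroup_of_pos ht]
  refine lintegral_congr_ae ?_
  filter_upwards [hgh] with y hy
  rw [hy]

theorem heatSemigroup_mono_ae {d : ℕ} {t : ℝ} (ht : 0 < t)
    {g h : EuclideanSpace ℝ (Fin d) → ℝ≥0∞} (hgh : g ≤ᵐ[volume] h)
    (x : EuclideanSpace ℝ (Fin d)) : heatSemigroup t g x ≤ heatSemigroup t h x := by
  rw [heatSemigroup_of_pos ht, heatSemigroup_of_pos ht]
  refine lintegral_mono_ae ?_
  filter_upwards [hgh] with y hy
  gcongr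

theorem heatSemigroup_mono {d : ℕ} (t : ℝ) {g h : EuclideanSpace ℝ (Fin d) → ℝ≥0∞}
    (hgh : ∀ y, g y ≤ h y) (x : EuclideanSpace ℝ (Fin d)) :
    heatSemigroup t g x ≤ heatSemigroup t h x := by
  unfold heatSemigroup
  split_ifs
  · gcongr
    exact hgh _
  · exact hgh x

theorem heatSemigroup_const_mul {d : ℕ} (t : ℝ) {c : ℝ≥0∞} (hc : c ≠ ⊤)
    (g : EuclideanSpace ℝ (Fin d) → ℝ≥0∞) (x : EuclideanSpace ℝ (Fin d)) :
    heatSemigroup t (fun y => c * g y) x = c * heatSemigroup t g x := by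
  unfold heatSemigroup
  split_ifs
  · rw [← lintegral_const_mul' _ _ hc]
    congr with y
    ring
  · rfl

theorem measurable_heatKernel_sub {d : ℕ} (t : ℝ) (x : EuclideanSpace ℝ (Fin d)) :
    Measurable fun y => ENNReal.ofReal (heatKernel t (x - y)) :=
  (measurable_heatKernel.comp (measurable_const.prodMk
    (measurable_const.sub measurable_id))).ennreal_ofReal

theorem heatSemigroup_add {d : ℕ} (t : ℝ) {g h : EuclideanSpace ℝ (Fin d) → ℝ≥0∞}
    (hg : Measurable g) (x : EuclideanSpace ℝ (Fin d)) :
    heatSemigroup t (fun y => g y + h y) x = heatSemigroup t g x + heatSemigroup t h x := by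
  unfold heatSemigroup
  split_ifs
  · simp_rw [mul_add]
    exact lintegral_add_left ((measurable_heatKernel_sub t x).mul hg) _
  · rfl

theorem heatSemigroup_const {d : ℕ} {t : ℝ} (ht : 0 < t) (c : ℝ≥0∞)
    (x : EuclideanSpace ℝ (Fin d)) : heatSemigroup t (fun _ => c) x = c := by
  rw [heatSemigroup_of_pos ht, lintegral_mul_const _ (measurable_heatKernel_sub t x),
    lintegral_heatKernel_sub ht, one_mul]

/-- The heat semigroup preserves joint measurability in space, time and a parameter. -/
theorem measurable_heatSemigroup {d : ℕ} {α : Type*} [MeasurableSpace α]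
    {τ : α → ℝ} {ξ : α → EuclideanSpace ℝ (Fin d)} {g : α → EuclideanSpace ℝ (Fin d) → ℝ≥0∞}
    (hτ : Measurable τ) (hξ : Measurable ξ) (hg : Measurable (Function.uncurry g)) :
    Measurable fun a => heatSemigroup (τ a) (g a) (ξ a) := by
  unfold heatSemigroup
  refine Measurable.ite (measurableSet_lt measurable_const hτ) ?_
    (hg.comp (measurable_id.prodMk hξ))
  refine Measurable.lintegral_prod_right' (f := fun p : α × EuclideanSpace ℝ (Fin d) =>
    ENNReal.ofReal (heatKernel (τ p.1) (ξ p.1 - p.2)) * g p.1 p.2) ?_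
  refine Measurable.mul ?_ hg
  exact (measurable_heatKernel.comp ((hτ.comp measurable_fst).prodMk
    ((hξ.comp measurable_fst).sub measurable_snd))).ennreal_ofReal

theorem measurable_heatSemigroup_apply {d : ℕ} (t : ℝ) {g : EuclideanSpace ℝ (Fin d) → ℝ≥0∞}
    (hg : Measurable g) : Measurable (heatSemigroup t g) :=
  measurable_heatSemigroup (g := fun _ => g) measurable_const measurable_id
    (hg.comp measurable_snd)

theorem heatSemigroup_heatSemigroup {d : ℕ} {t s : ℝ} (ht : 0 < t) (hs : 0 < s)
    {g : EuclideanSpace ℝ (Fin d) → ℝ≥0∞} (hg : Measurable g) (x : EuclideanSpace ℝ (Fin d)) :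
    heatSemigroup t (heatSemigroup s g) x = heatSemigroup (t + s) g x := by
  rw [heatSemigroup_of_pos ht, heatSemigroup_of_pos (by positivity : 0 < t + s)]
  simp_rw [heatSemigroup_of_pos hs, ← lintegral_const_mul' _ _ ENNReal.ofReal_ne_top]
  have hK : Measurable fun p : EuclideanSpace ℝ (Fin d) × EuclideanSpace ℝ (Fin d) =>
      ENNReal.ofReal (heatKernel s (p.1 - p.2)) :=
    (measurable_heatKernel.comp (measurable_const.prodMk
      (measurable_fst.sub measurable_snd))).ennreal_ofReal
  rw [lintegral_lintegral_swap]
  · refine lintegral_congr fun z => ?_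
    have hz : Measurable fun y => ENNReal.ofReal (heatKernel s (y - z)) :=
      (measurable_heatKernel.comp (measurable_const.prodMk
        (measurable_id.sub measurable_const))).ennreal_ofReal
    have hKz : Measurable fun y => ENNReal.ofReal (heatKernel t (x - y)) *
        ENNReal.ofReal (heatKernel s (y - z)) :=
      Measurable.mul (measurable_heatKernel_sub t x) hz
    rw [← lintegral_heatKernel_mul_heatKernel ht hs, ← lintegral_mul_const _ hKz]
    simp only [mul_assoc]
  · exact (((measurable_heatKernel_sub t x).comp measurable_fst).mul
      (hK.mul (hg.comp measurable_snd))).aemeasurable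

/-- Jensen's inequality for the heat semigroup. -/
theorem heatSemigroup_rpow_le {d : ℕ} {t m : ℝ} (ht : 0 < t) (hm : 1 ≤ m)
    {g : EuclideanSpace ℝ (Fin d) → ℝ≥0∞} (hg : Measurable g) (x : EuclideanSpace ℝ (Fin d)) :
    heatSemigroup t g x ^ m ≤ heatSemigroup t (fun y => g y ^ m) x := by
  have hk := measurable_heatKernel_sub t x
  -- The kernel centred at `x` is a probability density, so Jensen is the monotonicity of `L^p`
  -- norms in the exponent.
  let μ : Measure (EuclideanSpace ℝ (Fin d)) :=
    volume.withDensity fun y => ENNReal.ofReal (heatKernel t (x - y))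
  have hμ : IsProbabilityMeasure μ := ⟨by
    rw [withDensity_apply _ MeasurableSet.univ, Measure.restrict_univ,
      lintegral_heatKernel_sub ht]⟩
  have hS : ∀ h : EuclideanSpace ℝ (Fin d) → ℝ≥0∞, Measurable h →
      heatSemigroup t h x = ∫⁻ y, h y ∂μ := by
    intro h hh
    rw [heatSemigroup_of_pos ht, lintegral_withDensity_eq_lintegral_mul _ hk hh]
    rfl
  rw [hS g hg, hS _ (hg.pow_const m)]
  have h := eLpNorm'_le_eLpNorm'_of_exponent_le (μ := μ) one_pos hm
    hg.aestronglyMeasurable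
  simp only [eLpNorm', enorm_eq_self, ENNReal.rpow_one, div_one] at h
  calc _ ≤ ((∫⁻ y, g y ^ m ∂μ) ^ (1 / m)) ^ m := by gcongr
    _ = _ := by
      rw [← ENNReal.rpow_mul, one_div, inv_mul_cancel₀ (by positivity), ENNReal.rpow_one]

/-- Jensen for the concave power `1/m`. It is what makes roots of heat flows supersolutions of the
linear problem. -/
theorem heatSemigroup_rpow_inv_le {d : ℕ} {t m : ℝ} (ht : 0 < t) (hm : 1 ≤ m)
    {g : EuclideanSpace ℝ (Fin d) → ℝ≥0∞} (hg : Measurable g) (x : EuclideanSpace ℝ (Fin d)) :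
    heatSemigroup t (fun y => g y ^ (1 / m)) x ≤ heatSemigroup t g x ^ (1 / m) := by
  have hm0 : 0 < m := by positivity
  rw [one_div, ENNReal.le_rpow_inv_iff hm0]
  refine (heatSemigroup_rpow_le ht hm (hg.pow_const _) x).trans_eq ?_
  congr with y
  rw [← ENNReal.rpow_mul, inv_mul_cancel₀ hm0.ne', ENNReal.rpow_one]

theorem lintegral_heatSemigroup {d : ℕ} {t : ℝ} (ht : 0 < t)
    {g : EuclideanSpace ℝ (Fin d) → ℝ≥0∞} (hg : Measurable g) :
    ∫⁻ x, heatSemigroup t g x = ∫⁻ x, g x := by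
  simp_rw [heatSemigroup_of_pos ht]
  rw [lintegral_lintegral_swap]
  · refine lintegral_congr fun y => ?_
    have h : ∀ x, ENNReal.ofReal (heatKernel t (x - y)) =
        ENNReal.ofReal (heatKernel t (y - x)) := fun x => by
      rw [← heatKernel_neg, neg_sub]
    simp_rw [h]
    rw [lintegral_mul_const _ (measurable_heatKernel_sub t y), lintegral_heatKernel_sub ht,
      one_mul]
  · exact ((measurable_heatKernel.comp (measurable_const.prodMk
      (measurable_fst.sub measurable_snd))).ennreal_ofReal.mul
      (hg.comp measurable_snd)).aemeasurable

theorem heatSemigroup_le_mul_lintegral {d : ℕ} {t : ℝ} (ht : 0 < t)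
    (g : EuclideanSpace ℝ (Fin d) → ℝ≥0∞) (x : EuclideanSpace ℝ (Fin d)) :
    heatSemigroup t g x ≤
      ENNReal.ofReal ((4 * Real.pi * t) ^ (-((d : ℝ) / 2))) * ∫⁻ y, g y := by
  rw [heatSemigroup_of_pos ht, ← lintegral_const_mul' _ _ ENNReal.ofReal_ne_top]
  gcongr
  exact heatKernel_le ht _

/-- The smoothing estimate from `L^m` to `L^∞`. -/
theorem heatSemigroup_rpow_le_mul_lintegral {d : ℕ} {t m : ℝ} (ht : 0 < t) (hm : 1 ≤ m)
    {g : EuclideanSpace ℝ (Fin d) → ℝ≥0∞} (hg : Measurable g) (x : EuclideanSpace ℝ (Fin d)) :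
    heatSemigroup t g x ^ m ≤
      ENNReal.ofReal ((4 * Real.pi * t) ^ (-((d : ℝ) / 2))) * ∫⁻ y, g y ^ m :=
  (heatSemigroup_rpow_le ht hm hg x).trans (heatSemigroup_le_mul_lintegral ht _ x)

/-! ### Existence from a supersolution -/

noncomputable section

/-- The monotone extension to `[0,∞]` of a non-decreasing function on `[0,∞)`. -/
def monotoneExtension (f : ℝ≥0 → ℝ≥0) (a : ℝ≥0∞) : ℝ≥0∞ :=
  ⨆ (b : ℝ≥0) (_ : (b : ℝ≥0∞) ≤ a), (f b : ℝ≥0∞)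

/-- The right-hand side of the variation of constants formula. -/
def duhamel {d : ℕ} (g : ℝ≥0∞ → ℝ≥0∞) (U : EuclideanSpace ℝ (Fin d) → ℝ≥0∞)
    (v : EuclideanSpace ℝ (Fin d) × ℝ → ℝ≥0∞) (z : EuclideanSpace ℝ (Fin d) × ℝ) : ℝ≥0∞ :=
  heatSemigroup z.2 U z.1 +
    ∫⁻ s in Ioo 0 z.2, heatSemigroup (z.2 - s) (fun y => g (v (y, s))) z.1

end

theorem monotone_monotoneExtension (f : ℝ≥0 → ℝ≥0) : Monotone (monotoneExtension f) := by
  intro a b hab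
  exact iSup₂_le fun c hc => le_iSup₂_of_le c (hc.trans hab) le_rfl

theorem monotoneExtension_of_ne_top {f : ℝ≥0 → ℝ≥0} (hf : Monotone f) {a : ℝ≥0∞} (ha : a ≠ ⊤) :
    monotoneExtension f a = f a.toNNReal := by
  refine le_antisymm (iSup₂_le fun b hb => ?_) (le_iSup₂_of_le a.toNNReal
    (ENNReal.coe_toNNReal ha).le le_rfl)
  exact_mod_cast hf ((ENNReal.le_toNNReal_of_coe_le hb ha))

/-- The only use of the continuity of `f`: it lets the nonlinearity pass to the limit of the
iterates. -/
theorem monotoneExtension_iSup {f : ℝ≥0 → ℝ≥0} (hf : Monotone f) (hc : Continuous f)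
    {a : ℕ → ℝ≥0∞} (ha : Monotone a) (htop : ⨆ n, a n ≠ ⊤) :
    monotoneExtension f (⨆ n, a n) = ⨆ n, monotoneExtension f (a n) := by
  have hn : ∀ n, a n ≠ ⊤ := fun n => ne_top_of_le_ne_top htop (le_iSup a n)
  have h1 : Tendsto (fun n => monotoneExtension f (a n)) atTop
      (𝓝 (monotoneExtension f (⨆ n, a n))) := by
    simp_rw [monotoneExtension_of_ne_top hf htop, fun n => monotoneExtension_of_ne_top hf (hn n)]
    refine ENNReal.tendsto_coe.2 ((hc.tendsto _).comp ?_)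
    exact (ENNReal.tendsto_toNNReal htop).comp (tendsto_atTop_iSup ha)
  exact tendsto_nhds_unique h1
    (tendsto_atTop_iSup ((monotone_monotoneExtension f).comp ha))

theorem duhamel_mono {d : ℕ} {g : ℝ≥0∞ → ℝ≥0∞} (hg : Monotone g)
    (U : EuclideanSpace ℝ (Fin d) → ℝ≥0∞) {v w : EuclideanSpace ℝ (Fin d) × ℝ → ℝ≥0∞}
    {x : EuclideanSpace ℝ (Fin d)} {t : ℝ} (hvw : ∀ y, ∀ s ∈ Ioo 0 t, v (y, s) ≤ w (y, s)) :
    duhamel g U v (x, t) ≤ duhamel g U w (x, t) := by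
  unfold duhamel
  refine add_le_add le_rfl ?_
  exact setLIntegral_mono' measurableSet_Ioo fun s hs =>
    heatSemigroup_mono _ (fun y => hg (hvw y s hs)) _

theorem measurable_heatSemigroup_comp {d : ℕ} {g : ℝ≥0∞ → ℝ≥0∞} (hg : Measurable g)
    {v : EuclideanSpace ℝ (Fin d) × ℝ → ℝ≥0∞} (hv : Measurable v) :
    Measurable fun p : (EuclideanSpace ℝ (Fin d) × ℝ) × ℝ =>
      heatSemigroup (p.1.2 - p.2) (fun y => g (v (y, p.2))) p.1.1 := by
  refine measurable_heatSemigroup (α := (EuclideanSpace ℝ (Fin d) × ℝ) × ℝ)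
    (τ := fun p => p.1.2 - p.2) (ξ := fun p => p.1.1) (g := fun p y => g (v (y, p.2)))
    (by fun_prop) (by fun_prop) ?_
  exact hg.comp (hv.comp (by fun_prop))

theorem measurable_duhamel {d : ℕ} {g : ℝ≥0∞ → ℝ≥0∞} (hg : Measurable g)
    {U : EuclideanSpace ℝ (Fin d) → ℝ≥0∞} (hU : Measurable U)
    {v : EuclideanSpace ℝ (Fin d) × ℝ → ℝ≥0∞} (hv : Measurable v) :
    Measurable (duhamel g U v) := by
  unfold duhamel
  refine Measurable.add (measurable_heatSemigroup (g := fun _ => U) measurable_snd measurable_fst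
    (hU.comp measurable_snd)) ?_
  simp_rw [← lintegral_indicator measurableSet_Ioo]
  refine Measurable.lintegral_prod_right' (f := fun p : (EuclideanSpace ℝ (Fin d) × ℝ) × ℝ =>
    (Ioo 0 p.1.2).indicator
      (fun s => heatSemigroup (p.1.2 - s) (fun y => g (v (y, s))) p.1.1) p.2) ?_
  have h : MeasurableSet {p : (EuclideanSpace ℝ (Fin d) × ℝ) × ℝ | 0 < p.2 ∧ p.2 < p.1.2} :=
    (measurableSet_lt measurable_const measurable_snd).inter
      (measurableSet_lt measurable_snd (measurable_snd.comp measurable_fst))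
  have hi := (measurable_heatSemigroup_comp hg hv).indicator h
  convert! hi using 2

theorem heatSemigroup_iSup {d : ℕ} {t : ℝ} (ht : 0 < t)
    {g : ℕ → EuclideanSpace ℝ (Fin d) → ℝ≥0∞} (hg : ∀ n, Measurable (g n)) (hm : Monotone g)
    (x : EuclideanSpace ℝ (Fin d)) :
    heatSemigroup t (fun y => ⨆ n, g n y) x = ⨆ n, heatSemigroup t (g n) x := by
  simp_rw [heatSemigroup_of_pos ht, ENNReal.mul_iSup]
  have hmono : Monotone fun n y => ENNReal.ofReal (heatKernel t (x - y)) * g n y :=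
    fun i j hij y => mul_le_mul_right (hm hij y) _
  exact lintegral_iSup (fun n => (measurable_heatKernel_sub t x).mul (hg n)) hmono

/-- A finite supersolution dominates a solution, obtained by monotone iteration. -/
theorem exists_fixedPoint_duhamel_le {d : ℕ} {f : ℝ≥0 → ℝ≥0} (hc : Continuous f)
    (hf : Monotone f) {U : EuclideanSpace ℝ (Fin d) → ℝ≥0∞} (hU : Measurable U) {T : ℝ}
    {w : EuclideanSpace ℝ (Fin d) × ℝ → ℝ≥0∞}
    (hfin : ∀ x, ∀ t ∈ Ioo 0 T, w (x, t) < ⊤)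
    (hw : ∀ x, ∀ t ∈ Ioo 0 T, duhamel (monotoneExtension f) U w (x, t) ≤ w (x, t)) :
    ∃ u : EuclideanSpace ℝ (Fin d) × ℝ → ℝ≥0∞, Measurable u ∧
      (∀ x, ∀ t ∈ Ioo 0 T, u (x, t) ≤ w (x, t)) ∧
      ∀ x, ∀ t ∈ Ioo 0 T, u (x, t) = duhamel (monotoneExtension f) U u (x, t) := by
  set g := monotoneExtension f
  have hg : Monotone g := monotone_monotoneExtension f
  let v : ℕ → EuclideanSpace ℝ (Fin d) × ℝ → ℝ≥0∞ := fun n => (duhamel g U)^[n] 0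
  have hv0 : v 0 = 0 := rfl
  have hvs : ∀ n, v (n + 1) = duhamel g U (v n) := fun n => Function.iterate_succ_apply' _ _ _
  have hvm : ∀ n, Measurable (v n) := by
    intro n
    induction n with
    | zero => rw [hv0]; exact measurable_const
    | succ n ih => rw [hvs]; exact measurable_duhamel hg.measurable hU ih
  have hvmono : Monotone v := by
    refine monotone_nat_of_le_succ fun n => ?_
    induction n with
    | zero => rw [hv0]; exact fun _ => zero_le
    | succ n ih =>
      rw [hvs, hvs (n + 1)]
      exact fun z => duhamel_mono hg U fun y s _ => ih (y, s)
  have hvw : ∀ n x, ∀ t ∈ Ioo 0 T, v n (x, t) ≤ w (x, t) := by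
    intro n
    induction n with
    | zero => rw [hv0]; exact fun _ _ _ => zero_le
    | succ n ih =>
      intro x t ht
      rw [hvs]
      exact (duhamel_mono hg U fun y s hs => ih y s ⟨hs.1, hs.2.trans ht.2⟩).trans (hw x t ht)
  have huw : ∀ x, ∀ t ∈ Ioo 0 T, ⨆ n, v n (x, t) ≤ w (x, t) :=
    fun x t ht => iSup_le fun n => hvw n x t ht
  refine ⟨fun z => ⨆ n, v n z, Measurable.iSup hvm, huw, fun x t ht => ?_⟩
  have h1 : ⨆ n, v n (x, t) = ⨆ n, v (n + 1) (x, t) :=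
    ((hvmono.apply₂ (x, t)).iSup_nat_add 1).symm
  -- The limit is finite, being below `w`, so the supremum passes through the nonlinearity, and then
  -- through the semigroup by monotone convergence.
  have h2 : ∫⁻ s in Ioo 0 t, heatSemigroup (t - s) (fun y => g (⨆ n, v n (y, s))) x =
      ∫⁻ s in Ioo 0 t, ⨆ n, heatSemigroup (t - s) (fun y => g (v n (y, s))) x := by
    refine setLIntegral_congr_fun measurableSet_Ioo fun s hs => ?_
    have hsT : s ∈ Ioo 0 T := ⟨hs.1, hs.2.trans ht.2⟩
    have h3 : ∀ y, g (⨆ n, v n (y, s)) = ⨆ n, g (v n (y, s)) := fun y =>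
      monotoneExtension_iSup hf hc (hvmono.apply₂ (y, s))
        ((huw y s hsT).trans_lt (hfin y s hsT)).ne
    simp_rw [h3]
    exact heatSemigroup_iSup (sub_pos.2 hs.2)
      (fun n => hg.measurable.comp ((hvm n).comp measurable_prodMk_right))
      (fun i j hij y => hg (hvmono hij (y, s))) x
  have h4 : Monotone fun n s => heatSemigroup (t - s) (fun y => g (v n (y, s))) x :=
    fun i j hij s => heatSemigroup_mono _ (fun y => hg (hvmono hij (y, s))) x
  have h5 : ∀ n, Measurable fun s => heatSemigroup (t - s) (fun y => g (v n (y, s))) x :=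
    fun n => (measurable_heatSemigroup_comp hg.measurable (hvm n)).comp
      (measurable_prodMk_left (x := (x, t)))
  simp only [duhamel]
  rw [h1, h2, lintegral_iSup h5 h4, ENNReal.add_iSup]
  simp_rw [hvs]
  rfl

theorem isLocalLqSolution_of_supersolution {d : ℕ} {f : ℝ≥0 → ℝ≥0} (hc : Continuous f)
    (hf : Monotone f) {U : EuclideanSpace ℝ (Fin d) → ℝ≥0∞} (hU : Measurable U) {T : ℝ}
    (hT : 0 < T) {w : EuclideanSpace ℝ (Fin d) × ℝ → ℝ≥0∞}
    (hfin : ∀ x, ∀ t ∈ Ioo 0 T, w (x, t) < ⊤)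
    (hw : ∀ x, ∀ t ∈ Ioo 0 T, duhamel (monotoneExtension f) U w (x, t) ≤ w (x, t))
    {u₀ : EuclideanSpace ℝ (Fin d) → ℝ} (hu₀ : (fun y => ENNReal.ofReal (u₀ y)) =ᵐ[volume] U)
    {q M : ℝ≥0∞} (hM : M < ⊤) (hwM : ∀ t ∈ Ioo 0 T, eLpNorm (fun x => w (x, t)) q volume ≤ M) :
    ∃ u, IsLocalLqSolution f q u₀ u := by
  obtain ⟨u, hum, huw, hu⟩ := exists_fixedPoint_duhamel_le hc hf hU hfin hw
  -- The fixed-point identity is known only for `0 < t < T`; the slice `t = 0` is null.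
  have hne : ∀ᵐ z ∂(volume.restrict ((univ : Set (EuclideanSpace ℝ (Fin d))) ×ˢ Ico 0 T)),
      z.2 ∈ Ioo 0 T := by
    rw [ae_restrict_iff' (MeasurableSet.univ.prod measurableSet_Ico)]
    have h0 : ∀ᵐ z : EuclideanSpace ℝ (Fin d) × ℝ, z.2 ≠ 0 := by
      have : ∀ᵐ t : ℝ, t ≠ 0 := by simp [ae_iff]
      exact Measure.quasiMeasurePreserving_snd.ae this
    filter_upwards [h0] with z hz hz'
    exact ⟨lt_of_le_of_ne hz'.2.1 (Ne.symm hz), hz'.2.2⟩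
  refine ⟨u, T, hT, ⟨hum.aemeasurable, ?_, ?_⟩, ?_⟩
  · filter_upwards [hne] with z hz
    exact (huw z.1 z.2 hz).trans_lt (hfin z.1 z.2 hz)
  · filter_upwards [hne] with z hz
    have h := hu z.1 z.2 hz
    rw [heatSemigroup_congr_ae hz.1 hu₀]
    refine h.trans ?_
    simp only [duhamel]
    congr 1
    refine setLIntegral_congr_fun measurableSet_Ioo fun s hs => ?_
    have hsT : s ∈ Ioo 0 T := ⟨hs.1, hs.2.trans hz.2⟩
    congr with y
    exact monotoneExtension_of_ne_top hf ((huw y s hsT).trans_lt (hfin y s hsT)).ne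
  · refine lt_of_le_of_lt (essSup_le_of_ae_le M ?_) hM
    filter_upwards [ae_restrict_mem measurableSet_Ioo] with t ht
    refine le_trans (eLpNorm_mono_enorm fun x => ?_) (hwM t ht)
    simpa using huw x t ht

/-! ### Sufficiency for `q > 1` -/

theorem lintegral_rpow_Ioo {a t : ℝ} (ha : -1 < a) (ht : 0 < t) :
    ∫⁻ s in Ioo 0 t, ENNReal.ofReal (s ^ a) = ENNReal.ofReal (t ^ (a + 1) / (a + 1)) := by
  have hi : IntervalIntegrable (fun s : ℝ => s ^ a) volume 0 t :=
    intervalIntegral.intervalIntegrable_rpow' ha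
  rw [Measure.restrict_congr_set Ioo_ae_eq_Ioc,
    ← ofReal_integral_eq_lintegral_ofReal ((intervalIntegrable_iff_integrableOn_Ioc_of_le
      ht.le).1 hi), ← intervalIntegral.integral_of_le ht.le, integral_rpow (Or.inl ha),
    Real.zero_rpow (by linarith), sub_zero]
  filter_upwards [ae_restrict_mem measurableSet_Ioc] with s hs
  exact Real.rpow_nonneg hs.1.le _

theorem exists_measurable_representative {d : ℕ} {q : ℝ} (hq : 0 < q)
    {u₀ : EuclideanSpace ℝ (Fin d) → ℝ} (hu₀ : MemLp u₀ (ENNReal.ofReal q) volume) :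
    ∃ U : EuclideanSpace ℝ (Fin d) → ℝ≥0∞, Measurable U ∧ (∀ y, U y < ⊤) ∧
      (fun y => ENNReal.ofReal (u₀ y)) =ᵐ[volume] U ∧ ∫⁻ y, U y ^ q < ⊤ := by
  have hm := hu₀.aestronglyMeasurable
  have heq : (fun y => ENNReal.ofReal (u₀ y)) =ᵐ[volume]
      fun y => ENNReal.ofReal (hm.mk u₀ y) := by
    filter_upwards [hm.ae_eq_mk] with y hy
    rw [hy]
  refine ⟨fun y => ENNReal.ofReal (hm.mk u₀ y), hm.measurable_mk.ennreal_ofReal,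
    fun y => ENNReal.ofReal_lt_top, heq, ?_⟩
  have h := lintegral_rpow_enorm_lt_top_of_eLpNorm_lt_top
    (ENNReal.ofReal_pos.2 hq).ne' ENNReal.ofReal_ne_top hu₀.eLpNorm_lt_top
  rw [ENNReal.toReal_ofReal hq.le] at h
  refine lt_of_le_of_lt (lintegral_mono_ae ?_) h
  filter_upwards [heq] with y hy
  rw [← hy]
  gcongr
  exact Real.ofReal_le_enorm _

/-- For data in `L^m` the smoothing estimate holds with an arbitrarily small constant
for short times. -/
theorem exists_heatSemigroup_le_mul_rpow {d : ℕ} (hd : 0 < d) {m : ℝ} (hm : 1 ≤ m)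
    {φ : EuclideanSpace ℝ (Fin d) → ℝ≥0∞} (hφ : Measurable φ) (hfin : ∀ y, φ y < ⊤)
    (hint : ∫⁻ y, φ y ^ m < ⊤) {ε : ℝ} (hε : 0 < ε) :
    ∃ T : ℝ, 0 < T ∧ ∀ t ∈ Ioo 0 T, ∀ x,
      heatSemigroup t φ x ≤ ENNReal.ofReal (ε * t ^ (-(d / (2 * m)))) := by
  have hm0 : 0 < m := by linarith
  have hd0 : (0 : ℝ) < d := by exact_mod_cast hd
  -- Truncation at height `n`: the part above `n` has small `L^m` norm, and the part below
  -- contributes at most `n`, which `t^(-β)` dominates for short times.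
  let A : ℕ → Set (EuclideanSpace ℝ (Fin d)) := fun n => {y | (n : ℝ≥0∞) < φ y}
  have hA : ∀ n, MeasurableSet (A n) := fun n => measurableSet_lt measurable_const hφ
  have htend : Tendsto (fun n => ∫⁻ y, ((A n).indicator φ y) ^ m) atTop (𝓝 0) := by
    have h := tendsto_lintegral_of_dominated_convergence (μ := volume)
      (F := fun n y => ((A n).indicator φ y) ^ m) (f := fun _ => 0) (fun y => φ y ^ m)
      (fun n => (hφ.indicator (hA n)).pow_const m) (fun n => ae_of_all _ fun y => by
        have := indicator_le_self (A n) φ y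
        dsimp only
        gcongr) hint.ne
      (ae_of_all _ fun y => by
        obtain ⟨N, hN⟩ := ENNReal.exists_nat_gt (hfin y).ne
        refine tendsto_const_nhds.congr' ?_
        filter_upwards [eventually_ge_atTop N] with n hn
        have : y ∉ A n := by
          simp only [A, mem_ofPred_eq, not_lt]
          exact hN.le.trans (by exact_mod_cast hn)
        rw [indicator_of_notMem this, ENNReal.zero_rpow_of_pos hm0])
    simpa using h
  have hδ : 0 < ENNReal.ofReal ((ε / 2) ^ m) := ENNReal.ofReal_pos.2 (by positivity)
  obtain ⟨n, hn⟩ := (htend.eventually (gt_mem_nhds hδ)).exists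
  set β : ℝ := d / (2 * m) with hβ
  have hβ0 : 0 < β := by positivity
  -- This time solves `t^β = ε / (2(n+1))`, so that `n ≤ (ε/2) t^(-β)` before it; `n + 1` avoids
  -- dividing by zero.
  refine ⟨(ε / (2 * (n + 1))) ^ (1 / β), by positivity, fun t ht x => ?_⟩
  have hsplit : ∀ y, φ y ≤ (n : ℝ≥0∞) + (A n).indicator φ y := by
    intro y
    by_cases hy : y ∈ A n
    · rw [indicator_of_mem hy]; exact le_add_self
    · rw [indicator_of_notMem hy, add_zero]; exact not_lt.1 hy
  have h1 : heatSemigroup t ((A n).indicator φ) x ≤ ENNReal.ofReal (ε / 2 * t ^ (-β)) := by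
    rw [← ENNReal.rpow_le_rpow_iff hm0]
    refine (heatSemigroup_rpow_le_mul_lintegral ht.1 hm (hφ.indicator (hA n)) x).trans ?_
    refine (mul_le_mul_right hn.le _).trans ?_
    rw [← ENNReal.ofReal_mul (by have := ht.1; positivity),
      ENNReal.ofReal_rpow_of_nonneg (by have := ht.1; positivity) hm0.le,
      Real.mul_rpow (x := ε / 2) (by positivity) (by have := ht.1; positivity),
      ← Real.rpow_mul ht.1.le, mul_comm]
    refine ENNReal.ofReal_le_ofReal (mul_le_mul_of_nonneg_left ?_ (by positivity))
    rw [show -β * m = -((d : ℝ) / 2) by rw [hβ]; field_simp]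
    refine Real.rpow_le_rpow_of_nonpos ht.1 ?_ (by linarith)
    nlinarith [ht.1, Real.pi_gt_three]
  have h2 : (n : ℝ≥0∞) ≤ ENNReal.ofReal (ε / 2 * t ^ (-β)) := by
    rw [← ENNReal.ofReal_natCast]
    refine ENNReal.ofReal_le_ofReal ?_
    have h3 : t ^ β ≤ ε / (2 * (n + 1)) := by
      have := Real.rpow_le_rpow ht.1.le ht.2.le hβ0.le
      rwa [← Real.rpow_mul (by positivity), one_div, inv_mul_cancel₀ hβ0.ne', Real.rpow_one]
        at this
    have h4 : 0 < t ^ β := Real.rpow_pos_of_pos ht.1 _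
    rw [Real.rpow_neg ht.1.le, ← div_eq_mul_inv, le_div_iff₀ h4]
    calc (n : ℝ) * t ^ β ≤ (n + 1) * (ε / (2 * (n + 1))) := by gcongr; linarith
      _ = ε / 2 := by field_simp
  calc heatSemigroup t φ x ≤ heatSemigroup t (fun y => (n : ℝ≥0∞) + (A n).indicator φ y) x :=
        heatSemigroup_mono _ hsplit _
    _ = n + heatSemigroup t ((A n).indicator φ) x := by
        rw [heatSemigroup_add (g := fun _ => (n : ℝ≥0∞)) t measurable_const,
          heatSemigroup_const ht.1]
    _ ≤ ENNReal.ofReal (ε / 2 * t ^ (-β)) + ENNReal.ofReal (ε / 2 * t ^ (-β)) :=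
        add_le_add h2 h1
    _ = _ := by
        have := Real.rpow_nonneg ht.1.le (-β)
        rw [← ENNReal.ofReal_add (by positivity) (by positivity)]
        congr 1
        ring

theorem monotoneExtension_le_mul_add_rpow {f : ℝ≥0 → ℝ≥0} (hf : Monotone f) {C : ℝ≥0} {p : ℝ}
    (hp : 0 ≤ p) (hC : ∀ a, f a ≤ C * (a + a ^ p)) {a : ℝ≥0∞} (ha : a ≠ ⊤) :
    monotoneExtension f a ≤ C * (a + a ^ p) := by
  rw [monotoneExtension_of_ne_top hf ha]
  lift a to ℝ≥0 using ha
  rw [ENNReal.toNNReal_coe, ← ENNReal.coe_rpow_of_nonneg _ hp]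
  exact_mod_cast hC a

theorem hasLocalExistenceProperty_of_le_add_rpow {d : ℕ} (hd : 0 < d) {f : ℝ≥0 → ℝ≥0}
    (hc : Continuous f) (hf : Monotone f) {q : ℝ} (hq : 1 < q) {C : ℝ≥0}
    (hC : ∀ a, f a ≤ C * (a + a ^ (1 + 2 * q / (d : ℝ)))) :
    HasLocalExistenceProperty d f (ENNReal.ofReal q) := by
  intro u₀ hu₀ _
  have hq0 : 0 < q := by linarith
  have hd0 : (0 : ℝ) < d := by exact_mod_cast hd
  obtain ⟨U, hU, hUfin, hUeq, hUint⟩ := exists_measurable_representative hq0 hu₀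
  set p : ℝ := 1 + 2 * q / (d : ℝ) with hp
  have hp1 : 1 < p := by rw [hp]; linarith [show 0 < 2 * q / (d : ℝ) by positivity]
  -- `r < q` puts `φ = U^r` in `L^(q/r)` with `q/r ≥ 1`, `r < p` leaves a positive surplus power
  -- `κ`, and `1 < r` makes `s^(-βκ)` integrable at 0.
  obtain ⟨r, hr1, hr⟩ := exists_between (lt_min hq hp1)
  have hrq : r < q := hr.trans_le (min_le_left _ _)
  have hrp : r < p := hr.trans_le (min_le_right _ _)
  have hr0 : 0 < r := by linarith
  set φ : EuclideanSpace ℝ (Fin d) → ℝ≥0∞ := fun y => U y ^ r with hφdef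
  have hφ : Measurable φ := hU.pow_const r
  have hφU : ∀ y, φ y ^ (1 / r) = U y := fun y => by
    rw [hφdef]
    simp only
    rw [← ENNReal.rpow_mul, mul_one_div_cancel hr0.ne', ENNReal.rpow_one]
  have hφm : ∀ y, φ y ^ (q / r) = U y ^ q := fun y => by
    rw [hφdef]
    simp only
    rw [← ENNReal.rpow_mul, mul_div_cancel₀ _ hr0.ne']
  have hm1 : 1 ≤ q / r := (one_le_div hr0).2 hrq.le
  set β : ℝ := d / (2 * (q / r)) with hβ
  set κ : ℝ := p / r - 1 with hκ
  set l : ℝ := 1 - 1 / r with hl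
  set γ : ℝ := β * l with hγ
  have hβ0 : 0 < β := by positivity
  have hκ0 : 0 < κ := by rw [hκ, sub_pos]; exact (one_lt_div hr0).2 hrp
  have hl0 : 0 < l := by rw [hl, sub_pos]; exact (div_lt_one hr0).2 hr1
  have hγ0 : 0 < γ := by positivity
  -- Here the value of `p` enters: the gain `t^γ` from the time integral is exactly the loss
  -- `t^(-βl)` incurred in bounding `h` by `h^(1/r)`.
  have hβκ : -β * κ + 1 = γ := by
    rw [hγ, hβ, hκ, hl, hp]
    field_simp
    ring
  -- Chosen so that the superlinear term contributes at most `C/(2(C+1))`; the bound `T ≤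
  -- 1/(4(C+1))` below does the same for the linear term.
  set η : ℝ := γ / (2 * (C + 1) * 2 ^ p) with hη
  have hη0 : 0 < η := by positivity
  set ε : ℝ := η ^ (1 / (κ + l)) with hε
  have hε0 : 0 < ε := by positivity
  have hεη : ε ^ (κ + l) = η := by
    rw [hε, ← Real.rpow_mul hη0.le, one_div_mul_cancel (by positivity), Real.rpow_one]
  obtain ⟨T₁, hT₁, hS⟩ := exists_heatSemigroup_le_mul_rpow hd hm1 hφ
    (fun y => ENNReal.rpow_lt_top_of_nonneg hr0.le (hUfin y).ne) 
    (by simpa only [hφm] using hUint) hε0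
  set T : ℝ := min T₁ (1 / (4 * (C + 1))) with hT
  have hT0 : 0 < T := lt_min hT₁ (by positivity)
  set w : EuclideanSpace ℝ (Fin d) × ℝ → ℝ≥0∞ :=
    fun z => 2 * heatSemigroup z.2 φ z.1 ^ (1 / r) with hw
  have hSfin : ∀ x, ∀ t ∈ Ioo 0 T, heatSemigroup t φ x < ⊤ := fun x t ht =>
    (hS t ⟨ht.1, ht.2.trans_le (min_le_left _ _)⟩ x).trans_lt ENNReal.ofReal_lt_top
  have hwfin : ∀ x, ∀ t ∈ Ioo 0 T, w (x, t) < ⊤ := fun x t ht =>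
    ENNReal.mul_lt_top ENNReal.ofNat_lt_top
      (ENNReal.rpow_lt_top_of_nonneg (by positivity) (hSfin x t ht).ne)
  have hpt : ∀ x, ∀ t ∈ Ioo 0 T, ∀ s ∈ Ioo 0 t,
      heatSemigroup (t - s) (fun y => monotoneExtension f (w (y, s))) x ≤
        C * (w (x, t) + 2 ^ p * ENNReal.ofReal (ε ^ κ) * heatSemigroup t φ x *
          ENNReal.ofReal (s ^ (-β * κ))) := by
    intro x t ht s hs
    have hsT : s ∈ Ioo 0 T := ⟨hs.1, hs.2.trans ht.2⟩
    have hts : 0 < t - s := sub_pos.2 hs.2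
    have hhs : Measurable (heatSemigroup s φ) := measurable_heatSemigroup_apply s hφ
    have hsg : heatSemigroup (t - s) (heatSemigroup s φ) x = heatSemigroup t φ x := by
      rw [heatSemigroup_heatSemigroup hts hs.1 hφ, sub_add_cancel]
    set K : ℝ≥0∞ := 2 ^ p * ENNReal.ofReal (ε ^ κ * s ^ (-β * κ)) with hK
    have hKtop : K ≠ ⊤ := ENNReal.mul_ne_top
      (ENNReal.rpow_ne_top_of_nonneg (by linarith) ENNReal.ofNat_ne_top) ENNReal.ofReal_ne_top
    -- Only the surplus power `κ` is estimated by smoothing. One full power of `S(s)φ` is kept, on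
    -- which `S(t-s)` acts without loss.
    have hpow : ∀ y, monotoneExtension f (w (y, s)) ≤
        C * (2 * heatSemigroup s φ y ^ (1 / r) + K * heatSemigroup s φ y) := by
      intro y
      refine (monotoneExtension_le_mul_add_rpow hf (by linarith) hC (hwfin y s hsT).ne).trans ?_
      gcongr
      calc w (y, s) ^ p = 2 ^ p * heatSemigroup s φ y ^ (κ + 1) := by
            rw [hw]
            simp only
            rw [ENNReal.mul_rpow_of_nonneg _ _ (by linarith), ← ENNReal.rpow_mul, hκ]
            congr 2
            ring
        _ = 2 ^ p * (heatSemigroup s φ y ^ κ * heatSemigroup s φ y) := by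
            rw [ENNReal.rpow_add_of_nonneg _ _ hκ0.le zero_le_one, ENNReal.rpow_one]
        _ ≤ 2 ^ p * (ENNReal.ofReal (ε * s ^ (-β)) ^ κ * heatSemigroup s φ y) := by
            gcongr
            exact hS s ⟨hs.1, hsT.2.trans_le (min_le_left _ _)⟩ y
        _ = K * heatSemigroup s φ y := by
            have := hs.1
            rw [ENNReal.ofReal_rpow_of_nonneg (by positivity) hκ0.le,
              Real.mul_rpow hε0.le (by positivity), ← Real.rpow_mul hs.1.le, hK, mul_assoc]
    have hhr : Measurable fun y => 2 * heatSemigroup s φ y ^ (1 / r) :=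
      measurable_const.mul (hhs.pow_const _)
    refine (heatSemigroup_mono _ hpow x).trans ?_
    rw [heatSemigroup_const_mul _ ENNReal.coe_ne_top,
      heatSemigroup_add _ hhr,
      heatSemigroup_const_mul _ ENNReal.ofNat_ne_top, heatSemigroup_const_mul _ hKtop, hsg]
    refine mul_le_mul_right (add_le_add ?_ (le_of_eq ?_)) _
    · rw [hw]
      refine mul_le_mul_right ((heatSemigroup_rpow_inv_le hts hr1.le hhs x).trans_eq ?_) _
      rw [hsg]
    · rw [hK, ENNReal.ofReal_mul (by positivity)]
      ring
  refine isLocalLqSolution_of_supersolution (w := w) hc hf hU hT0 hwfin ?_ hUeq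
    (M := (2 ^ q * ∫⁻ y, U y ^ q) ^ (1 / q)) ?_ ?_
  · intro x t ht
    have ht1 : t < T₁ := ht.2.trans_le (min_le_left _ _)
    have ht2 : t ≤ 1 / (4 * (C + 1)) := ht.2.le.trans (min_le_right _ _)
    set h : ℝ≥0∞ := heatSemigroup t φ x with hh
    have hlin : heatSemigroup t U x ≤ h ^ (1 / r) := by
      have := heatSemigroup_rpow_inv_le ht.1 hr1.le hφ x
      simpa only [hφU] using this
    have hh1 : h ≤ ENNReal.ofReal (ε ^ l * t ^ (-γ)) * h ^ (1 / r) := by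
      calc h = h ^ l * h ^ (1 / r) := by
            rw [← ENNReal.rpow_add_of_nonneg _ _ hl0.le (by positivity), hl, sub_add_cancel,
              ENNReal.rpow_one]
        _ ≤ ENNReal.ofReal (ε * t ^ (-β)) ^ l * h ^ (1 / r) := by
            gcongr
            exact hS t ⟨ht.1, ht1⟩ x
        _ = _ := by
            have := ht.1
            rw [ENNReal.ofReal_rpow_of_nonneg (by positivity) hl0.le,
              Real.mul_rpow hε0.le (by positivity), ← Real.rpow_mul ht.1.le, hγ, neg_mul]
    have hint : ∫⁻ s in Ioo 0 t,
        heatSemigroup (t - s) (fun y => monotoneExtension f (w (y, s))) x ≤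
        C * (w (x, t) * ENNReal.ofReal t + 2 ^ p * ENNReal.ofReal (ε ^ κ) * h *
          ENNReal.ofReal (t ^ γ / γ)) := by
      refine (setLIntegral_mono' measurableSet_Ioo (hpt x t ht)).trans_eq ?_
      rw [lintegral_const_mul _ (by fun_prop), lintegral_add_left measurable_const,
        lintegral_const, lintegral_const_mul _ (by fun_prop),
        lintegral_rpow_Ioo (by linarith) ht.1, hβκ]
      simp [hh]
    have hreal : (C : ℝ) * (2 * t + 2 ^ p * (ε ^ κ * (ε ^ l * t ^ (-γ)) * (t ^ γ / γ))) ≤ 1 := by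
      have e1 : ε ^ κ * (ε ^ l * t ^ (-γ)) * (t ^ γ / γ) = η / γ := by
        rw [← hεη, Real.rpow_add hε0, Real.rpow_neg ht.1.le]
        have := Real.rpow_pos_of_pos ht.1 γ
        field_simp
      have e2 : 2 ^ p * (η / γ) = 1 / (2 * (C + 1)) := by
        rw [hη]
        field_simp
      rw [e1, e2]
      have hC0 : (0 : ℝ) ≤ C := C.2
      calc (C : ℝ) * (2 * t + 1 / (2 * (C + 1)))
          ≤ C * (2 * (1 / (4 * (C + 1))) + 1 / (2 * (C + 1))) := by gcongr
        _ = C / (C + 1) := by field_simp; ring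
        _ ≤ 1 := by rw [div_le_one (by positivity)]; linarith
    have ht0 := ht.1
    calc duhamel (monotoneExtension f) U w (x, t)
        ≤ h ^ (1 / r) + C * (2 * h ^ (1 / r) * ENNReal.ofReal t +
          2 ^ p * ENNReal.ofReal (ε ^ κ) * (ENNReal.ofReal (ε ^ l * t ^ (-γ)) * h ^ (1 / r)) *
          ENNReal.ofReal (t ^ γ / γ)) := by
          refine add_le_add hlin (hint.trans ?_)
          gcongr
      _ = (1 + ENNReal.ofReal (C * (2 * t +
            2 ^ p * (ε ^ κ * (ε ^ l * t ^ (-γ)) * (t ^ γ / γ))))) * h ^ (1 / r) := by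
          rw [ENNReal.ofReal_mul C.coe_nonneg, ENNReal.ofReal_add (by positivity) (by positivity),
            ENNReal.ofReal_mul (p := 2) (by norm_num),
            ENNReal.ofReal_mul (p := 2 ^ p) (by positivity),
            ENNReal.ofReal_mul (p := ε ^ κ * (ε ^ l * t ^ (-γ))) (by positivity),
            ENNReal.ofReal_mul (p := ε ^ κ) (by positivity),
            ENNReal.ofReal_coe_nnreal, ← ENNReal.ofReal_rpow_of_pos (by norm_num : (0:ℝ) < 2),
            ENNReal.ofReal_ofNat]
          ring
      _ ≤ (1 + 1) * h ^ (1 / r) := by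
          gcongr
          exact ENNReal.ofReal_le_one.2 hreal
      _ = w (x, t) := by rw [one_add_one_eq_two]
  · refine ENNReal.rpow_lt_top_of_nonneg (by positivity) (ENNReal.mul_ne_top
      (ENNReal.rpow_ne_top_of_nonneg hq0.le ENNReal.ofNat_ne_top) hUint.ne)
  · intro t ht
    rw [eLpNorm_eq_lintegral_rpow_enorm_toReal (ENNReal.ofReal_pos.2 hq0).ne'
      ENNReal.ofReal_ne_top, ENNReal.toReal_ofReal hq0.le]
    gcongr
    simp only [enorm_eq_self, hw]
    calc ∫⁻ x, (2 * heatSemigroup t φ x ^ (1 / r)) ^ q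
        = 2 ^ q * ∫⁻ x, heatSemigroup t φ x ^ (q / r) := by
          rw [← lintegral_const_mul _ ((measurable_heatSemigroup_apply t hφ).pow_const _)]
          refine lintegral_congr fun x => ?_
          rw [ENNReal.mul_rpow_of_nonneg _ _ hq0.le, ← ENNReal.rpow_mul, one_div_mul_eq_div]
      _ ≤ 2 ^ q * ∫⁻ x, heatSemigroup t (fun y => φ y ^ (q / r)) x := by
          gcongr
          exact heatSemigroup_rpow_le ht.1 hm1 hφ _
      _ = 2 ^ q * ∫⁻ y, U y ^ q := by
          rw [lintegral_heatSemigroup ht.1 (hφ.pow_const _)]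
          simp only [hφm]

/-! ### The growth conditions -/

theorem exists_le_mul_of_limsup_lt_top {f : ℝ≥0 → ℝ≥0}
    (h : limsup (fun s : ℝ≥0 => (f s : ℝ≥0∞) / (s : ℝ≥0∞)) (𝓝[>] 0) < ⊤) :
    ∃ C δ : ℝ≥0, 0 < δ ∧ ∀ s, 0 < s → s < δ → f s ≤ C * s := by
  obtain ⟨C, hC, -⟩ := ENNReal.lt_iff_exists_nnreal_btwn.1 h
  have he := eventually_lt_of_limsup_lt hC
  obtain ⟨δ, hδ, hs⟩ := mem_nhdsGT_iff_exists_Ioo_subset.1 he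
  refine ⟨C, δ, hδ, fun s hs0 hsδ => ?_⟩
  have h1 : (f s : ℝ≥0∞) / s < C := hs ⟨hs0, hsδ⟩
  have h2 := (ENNReal.div_le_iff_le_mul (Or.inl (by exact_mod_cast hs0.ne'))
    (Or.inl ENNReal.coe_ne_top)).1 h1.le
  exact_mod_cast h2

theorem map_zero_of_limsup_lt_top {f : ℝ≥0 → ℝ≥0} (hf : Monotone f)
    (h : limsup (fun s : ℝ≥0 => (f s : ℝ≥0∞) / (s : ℝ≥0∞)) (𝓝[>] 0) < ⊤) : f 0 = 0 := by
  obtain ⟨C, δ, hδ, hC⟩ := exists_le_mul_of_limsup_lt_top h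
  have ht : Tendsto (fun s : ℝ≥0 => C * s) (𝓝[>] 0) (𝓝 (C * 0)) :=
    (tendsto_const_nhds.mul tendsto_id).mono_left nhdsWithin_le_nhds
  rw [mul_zero] at ht
  refine le_antisymm (ge_of_tendsto ht ?_) zero_le
  filter_upwards [Ioo_mem_nhdsGT hδ] with s hs
  exact (hf zero_le).trans (hC s hs.1 hs.2)

theorem monotone_supQuotient (f : ℝ≥0 → ℝ≥0) : Monotone (supQuotient f) := by
  intro a b hab
  exact iSup₂_le fun t ht => le_iSup₂_of_le t ⟨ht.1, ht.2.trans hab⟩ le_rfl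

/-- The quotient is bounded near 0 by hypothesis, and by `f s / δ` on `[δ, s]` by monotonicity. -/
theorem supQuotient_lt_top {f : ℝ≥0 → ℝ≥0} (hf : Monotone f)
    (h : limsup (fun s : ℝ≥0 => (f s : ℝ≥0∞) / (s : ℝ≥0∞)) (𝓝[>] 0) < ⊤) (s : ℝ≥0) :
    supQuotient f s < ⊤ := by
  obtain ⟨C, δ, hδ, hC⟩ := exists_le_mul_of_limsup_lt_top h
  refine lt_of_le_of_lt (b := ((C + f s / δ : ℝ≥0) : ℝ≥0∞)) (iSup₂_le fun t ht => ?_)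
    ENNReal.coe_lt_top
  refine ENNReal.div_le_of_le_mul ?_
  rw [← ENNReal.coe_mul, ENNReal.coe_le_coe, add_mul]
  rcases lt_or_ge t δ with htδ | htδ
  · exact (hC t ht.1 htδ).trans le_self_add
  · calc f t ≤ f s := hf ht.2
      _ = f s / δ * δ := by field_simp
      _ ≤ f s / δ * t := by gcongr
      _ ≤ _ := le_add_self

/-- The linear term covers small `a`, and also the middle range `[δ, N]` through `f a ≤ f N ≤ (f N /
δ) a`; the power covers large `a`. -/
theorem exists_le_mul_add_rpow {f : ℝ≥0 → ℝ≥0} (hf : Monotone f) {p : ℝ}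
    (h0 : limsup (fun s : ℝ≥0 => (f s : ℝ≥0∞) / (s : ℝ≥0∞)) (𝓝[>] 0) < ⊤)
    (h : limsup (fun s : ℝ≥0 => ((s ^ (-p) * f s : ℝ≥0) : ℝ≥0∞)) atTop < ⊤) :
    ∃ C : ℝ≥0, ∀ a, f a ≤ C * (a + a ^ p) := by
  obtain ⟨C₂, hC₂, -⟩ := ENNReal.lt_iff_exists_nnreal_btwn.1 h
  obtain ⟨N, hN⟩ := eventually_atTop.1 (eventually_lt_of_limsup_lt hC₂)
  obtain ⟨C₁, δ, hδ, hC₁⟩ := exists_le_mul_of_limsup_lt_top h0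
  refine ⟨C₁ + f N / δ + C₂, fun a => ?_⟩
  rcases eq_or_ne a 0 with rfl | ha
  · rw [map_zero_of_limsup_lt_top hf h0]
    exact zero_le
  have ha0 : 0 < a := pos_iff_ne_zero.2 ha
  rcases lt_or_ge a δ with haδ | haδ
  · refine (hC₁ a ha0 haδ).trans ?_
    gcongr
    · exact le_add_right le_self_add
    · exact le_self_add
  rcases le_or_gt a N with haN | haN
  · calc f a ≤ f N := hf haN
      _ = f N / δ * δ := by field_simp
      _ ≤ f N / δ * a := by gcongr
      _ ≤ _ := by
        gcongr
        · exact le_add_right le_add_self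
        · exact le_self_add
  · have h1 : a ^ (-p) * f a ≤ C₂ := by exact_mod_cast (hN a haN.le).le
    calc f a = a ^ p * (a ^ (-p) * f a) := by
          rw [← mul_assoc, ← NNReal.rpow_add ha, add_neg_cancel, NNReal.rpow_zero, one_mul]
      _ ≤ a ^ p * C₂ := by gcongr
      _ = C₂ * a ^ p := mul_comm _ _
      _ ≤ _ := by
        gcongr
        · exact le_add_self
        · exact le_add_self

/-- The substitution `σ = A s^{-α}`. -/
theorem lintegral_comp_mul_rpow_neg {α A τ : ℝ} (hα : 0 < α) (hA : 0 < A) (hτ : 0 < τ)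
    (g : ℝ → ℝ≥0∞) :
    ∫⁻ σ in Ioi (A * τ ^ (-α)), ENNReal.ofReal (σ ^ (-(1 + 1 / α))) * g σ =
      ENNReal.ofReal (α * A ^ (-(1 / α))) * ∫⁻ s in Ioo 0 τ, g (A * s ^ (-α)) := by
  have himage : (fun s : ℝ => A * s ^ (-α)) '' Ioo 0 τ = Ioi (A * τ ^ (-α)) := by
    ext σ
    constructor
    · rintro ⟨s, hs, rfl⟩
      exact mul_lt_mul_of_pos_left (Real.rpow_lt_rpow_of_neg hs.1 hs.2 (neg_lt_zero.2 hα)) hA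
    · intro hσ
      have hστ : τ ^ (-α) < σ / A := by
        rw [lt_div_iff₀ hA, mul_comm]
        exact hσ
      have hσA : 0 < σ / A := (Real.rpow_pos_of_pos hτ _).trans hστ
      refine ⟨(σ / A) ^ (-(1 / α)), ⟨Real.rpow_pos_of_pos hσA _, ?_⟩, ?_⟩
      · have h1 := Real.rpow_lt_rpow_of_neg (Real.rpow_pos_of_pos hτ _) hστ
          (neg_lt_zero.2 (one_div_pos.2 hα))
        rwa [← Real.rpow_mul hτ.le, neg_mul_neg, mul_one_div_cancel hα.ne', Real.rpow_one] at h1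
      · simp only
        rw [← Real.rpow_mul hσA.le, neg_mul_neg, one_div_mul_cancel hα.ne', Real.rpow_one]
        field_simp
  have hanti : AntitoneOn (fun s : ℝ => A * s ^ (-α)) (Ioo 0 τ) := by
    intro s hs t ht hst
    exact mul_le_mul_of_nonneg_left
      (Real.rpow_le_rpow_of_nonpos hs.1 hst (neg_nonpos.2 hα.le)) hA.le
  have hderiv : ∀ s ∈ Ioo 0 τ, HasDerivWithinAt (fun s : ℝ => A * s ^ (-α))
      (A * (-α * s ^ (-α - 1))) (Ioo 0 τ) s := fun s hs =>
    ((Real.hasDerivAt_rpow_const (Or.inl hs.1.ne')).const_mul A).hasDerivWithinAt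
  rw [← himage, lintegral_image_eq_lintegral_deriv_mul_of_antitoneOn measurableSet_Ioo hderiv
    hanti, ← lintegral_const_mul' _ _ ENNReal.ofReal_ne_top]
  refine setLIntegral_congr_fun measurableSet_Ioo fun s hs => ?_
  have hs0 := hs.1
  have hpos : 0 < s ^ (-α) := Real.rpow_pos_of_pos hs0 _
  rw [← mul_assoc, ← ENNReal.ofReal_mul (by
    have := Real.rpow_nonneg hs0.le (-α - 1)
    rw [neg_mul, mul_neg, neg_neg]
    positivity)]
  congr 2
  rw [Real.mul_rpow hA.le hpos.le, ← Real.rpow_mul hs0.le,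
    show -α * -(1 + 1 / α) = α + 1 by field_simp, neg_add, Real.rpow_add hA, Real.rpow_neg_one,
    show -α - 1 = -(α + 1) by ring, Real.rpow_neg hs0.le]
  have := Real.rpow_pos_of_pos hs0 (α + 1)
  field_simp

/-! ### Sufficiency for `q = 1` -/

theorem monotoneExtension_le_supQuotient_mul {f : ℝ≥0 → ℝ≥0} (hf : Monotone f) (hf0 : f 0 = 0)
    {a : ℝ≥0∞} {b : ℝ≥0} (hab : a ≤ b) : monotoneExtension f a ≤ supQuotient f b * a := by
  rw [monotoneExtension_of_ne_top hf (ne_top_of_le_ne_top ENNReal.coe_ne_top hab)]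
  lift a to ℝ≥0 using ne_top_of_le_ne_top ENNReal.coe_ne_top hab
  rw [ENNReal.toNNReal_coe]
  rcases eq_or_ne a 0 with rfl | ha
  · simp [hf0]
  · rw [← ENNReal.div_le_iff_le_mul (Or.inl (by exact_mod_cast ha)) (Or.inl ENNReal.coe_ne_top)]
    exact le_iSup₂_of_le a ⟨pos_iff_ne_zero.2 ha, by exact_mod_cast hab⟩ le_rfl

/-- The supersolution is `w = 2 S(t)U`. Since `S(t-s)w(s) = w(t)` exactly, the Duhamel integral is
at most `w(t) ∫ F(A s^(-d/2)) ds`, and the integral is at most 1/2 on a short interval. -/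
theorem hasLocalExistenceProperty_one {d : ℕ} (hd : 0 < d) {f : ℝ≥0 → ℝ≥0}
    (hc : Continuous f) (hf : Monotone f)
    (h0 : limsup (fun s : ℝ≥0 => (f s : ℝ≥0∞) / (s : ℝ≥0∞)) (𝓝[>] 0) < ⊤)
    (hint : (∫⁻ s in Ioi (1 : ℝ),
        ENNReal.ofReal (s ^ (-(1 + 2 / (d : ℝ)))) * supQuotient f s.toNNReal) < ⊤) :
    HasLocalExistenceProperty d f 1 := by
  intro u₀ hu₀ _
  rw [← ENNReal.ofReal_one] at hu₀
  obtain ⟨U, hU, hUfin, hUeq, hUint⟩ := exists_measurable_representative one_pos hu₀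
  simp only [ENNReal.rpow_one] at hUint
  have hd0 : (0 : ℝ) < d := by exact_mod_cast hd
  set α : ℝ := d / 2 with hα
  have hα0 : 0 < α := by positivity
  set I : ℝ := (∫⁻ y, U y).toReal with hI
  have hIU : ∫⁻ y, U y = ENNReal.ofReal I := (ENNReal.ofReal_toReal hUint.ne).symm
  have hI0 : 0 ≤ I := ENNReal.toReal_nonneg
  set A : ℝ := 2 * (I + 1) with hA
  have hA0 : 0 < A := by positivity
  set G : ℝ → ℝ≥0∞ := fun s => supQuotient f (A * s ^ (-α)).toNNReal with hG
  have hGm : Measurable G :=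
    (monotone_supQuotient f).measurable.comp (by fun_prop)
  -- Under `σ = A s^(-α)` the interval `(0, τ)` corresponds to `σ > 1`, the domain in the
  -- hypothesis.
  set τ : ℝ := A ^ (1 / α) with hτ
  have hτ0 : 0 < τ := by positivity
  have hAτ : A * τ ^ (-α) = 1 := by
    rw [hτ, ← Real.rpow_mul hA0.le, mul_neg, one_div_mul_cancel hα0.ne', Real.rpow_neg_one,
      mul_inv_cancel₀ hA0.ne']
  have hGint : ∫⁻ s in Ioo 0 τ, G s ≠ ⊤ := by
    have h := lintegral_comp_mul_rpow_neg hα0 hA0 hτ0 (fun σ => supQuotient f σ.toNNReal)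
    rw [hAτ, show 1 / α = 2 / (d : ℝ) by rw [hα]; field_simp] at h
    intro htop
    rw [h] at hint
    have hne : ENNReal.ofReal (α * A ^ (-(2 / (d : ℝ)))) ≠ 0 :=
      (ENNReal.ofReal_pos.2 (by positivity)).ne'
    refine hint.ne ?_
    change _ * ∫⁻ s in Ioo 0 τ, G s = ⊤
    rw [htop, ENNReal.mul_top hne]
  obtain ⟨δ, hδ, hδG⟩ := exists_pos_setLIntegral_lt_of_measure_lt hGint
    (ε := 2⁻¹) (by simp)
  obtain ⟨T, hT0, hT⟩ : ∃ T : ℝ, 0 < T ∧ ∫⁻ s in Ioo 0 T, G s ≤ 2⁻¹ := by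
    obtain ⟨η, hη0, hηδ⟩ := ENNReal.lt_iff_exists_nnreal_btwn.1 hδ
    have hη0' : 0 < η := by exact_mod_cast hη0
    refine ⟨min τ η, lt_min hτ0 (by exact_mod_cast hη0'), ?_⟩
    have h := hδG (Ioo 0 (min τ η)) (by
      refine lt_of_le_of_lt ((Measure.restrict_apply_le _ _).trans ?_) hηδ
      rw [Real.volume_Ioo, sub_zero]
      exact (ENNReal.ofReal_le_ofReal (min_le_right _ _)).trans_eq ENNReal.ofReal_coe_nnreal)
    rw [Measure.restrict_restrict measurableSet_Ioo, inter_eq_left.2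
      (Ioo_subset_Ioo_right (min_le_left _ _))] at h
    exact h.le
  set w : EuclideanSpace ℝ (Fin d) × ℝ → ℝ≥0∞ := fun z => 2 * heatSemigroup z.2 U z.1 with hw
  have hwA : ∀ x t, 0 < t → w (x, t) ≤ ((A * t ^ (-α)).toNNReal : ℝ≥0∞) := by
    intro x t ht
    change _ ≤ ENNReal.ofReal _
    have h1 : (4 * Real.pi * t) ^ (-α) ≤ t ^ (-α) :=
      Real.rpow_le_rpow_of_nonpos ht (by nlinarith [ht, Real.pi_gt_three]) (by linarith)
    calc w (x, t) ≤ 2 * (ENNReal.ofReal ((4 * Real.pi * t) ^ (-α)) * ∫⁻ y, U y) :=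
          mul_le_mul_right (heatSemigroup_le_mul_lintegral ht U x) _
      _ ≤ ENNReal.ofReal 2 * (ENNReal.ofReal (t ^ (-α)) * ENNReal.ofReal (I + 1)) := by
          rw [hIU, ENNReal.ofReal_ofNat]
          gcongr
          linarith
      _ = _ := by
          rw [← ENNReal.ofReal_mul (by positivity), ← ENNReal.ofReal_mul (by norm_num), hA]
          congr 1
          ring
  refine isLocalLqSolution_of_supersolution (w := w) hc hf hU hT0
    (fun x t ht => (hwA x t ht.1).trans_lt ENNReal.coe_lt_top) ?_ hUeq
    (M := 2 * ∫⁻ y, U y) (ENNReal.mul_lt_top ENNReal.ofNat_lt_top hUint) ?_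
  · intro x t ht
    have hpt : ∀ s ∈ Ioo 0 t,
        heatSemigroup (t - s) (fun y => monotoneExtension f (w (y, s))) x ≤ G s * w (x, t) := by
      intro s hs
      refine (heatSemigroup_mono _ (fun y => monotoneExtension_le_supQuotient_mul hf
        (map_zero_of_limsup_lt_top hf h0) (hwA y s hs.1)) x).trans_eq ?_
      rw [heatSemigroup_const_mul _ (supQuotient_lt_top hf h0 _).ne]
      change G s * heatSemigroup (t - s) (fun y => 2 * heatSemigroup s U y) x = _
      rw [heatSemigroup_const_mul _ ENNReal.ofNat_ne_top,
        heatSemigroup_heatSemigroup (sub_pos.2 hs.2) hs.1 hU, sub_add_cancel]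
    calc duhamel (monotoneExtension f) U w (x, t)
        ≤ heatSemigroup t U x + (∫⁻ s in Ioo 0 T, G s) * w (x, t) := by
          refine add_le_add le_rfl ?_
          refine (setLIntegral_mono' measurableSet_Ioo hpt).trans ?_
          rw [lintegral_mul_const _ hGm]
          gcongr
          exact ht.2.le
      _ ≤ heatSemigroup t U x + 2⁻¹ * (2 * heatSemigroup t U x) := by
          gcongr
      _ = w (x, t) := by
          rw [← mul_assoc, ENNReal.inv_mul_cancel (by simp) (by simp), one_mul, ← two_mul]
  · intro t ht
    rw [eLpNorm_one_eq_lintegral_enorm]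
    simp only [enorm_eq_self, hw]
    rw [lintegral_const_mul _ (measurable_heatSemigroup_apply t hU),
      lintegral_heatSemigroup ht.1 hU]

/-! ### Lower bounds for the heat semigroup -/

theorem le_heatSemigroup_indicator {d : ℕ} {t : ℝ} (ht : 0 < t)
    {B : Set (EuclideanSpace ℝ (Fin d))} {x z : EuclideanSpace ℝ (Fin d)} {ρ R : ℝ} (hρ : 0 < ρ)
    (hB : Metric.ball z ρ ⊆ B) (hR : ∀ y ∈ Metric.ball z ρ, ‖x - y‖ ≤ R) :
    ENNReal.ofReal ((4 * Real.pi * t) ^ (-((d : ℝ) / 2)) * Real.exp (-R ^ 2 / (4 * t)) * ρ ^ d) *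
        volume (Metric.ball (0 : EuclideanSpace ℝ (Fin d)) 1) ≤
      heatSemigroup t (B.indicator fun _ => 1) x := by
  have hvol : volume (Metric.ball z ρ) =
      ENNReal.ofReal (ρ ^ d) * volume (Metric.ball (0 : EuclideanSpace ℝ (Fin d)) 1) := by
    rw [Measure.addHaar_ball_of_pos volume z hρ, finrank_euclideanSpace_fin]
  rw [ENNReal.ofReal_mul (by positivity), mul_assoc, ← hvol, heatSemigroup_of_pos ht,
    ← setLIntegral_const]
  refine (setLIntegral_mono' measurableSet_ball fun y hy => ?_).trans
    (setLIntegral_le_lintegral (Metric.ball z ρ) _)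
  rw [indicator_of_mem (hB hy), mul_one]
  refine ENNReal.ofReal_le_ofReal ?_
  unfold heatKernel
  gcongr
  exact hR y hy

theorem rpow_neg_half_mul_sqrt_pow {d : ℕ} {t : ℝ} (ht : 0 < t) :
    t ^ (-((d : ℝ) / 2)) * √t ^ d = 1 := by
  rw [Real.sqrt_eq_rpow, ← Real.rpow_natCast, ← Real.rpow_mul ht.le, ← Real.rpow_add ht,
    show -((d : ℝ) / 2) + 1 / 2 * d = 0 by ring, Real.rpow_zero]

theorem volume_unitBall_toReal_pos (d : ℕ) :
    0 < (volume (Metric.ball (0 : EuclideanSpace ℝ (Fin d)) 1)).toReal :=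
  ENNReal.toReal_pos (Metric.measure_ball_pos _ _ one_pos).ne' measure_ball_lt_top.ne

theorem ofReal_volume_unitBall (d : ℕ) :
    ENNReal.ofReal (volume (Metric.ball (0 : EuclideanSpace ℝ (Fin d)) 1)).toReal =
      volume (Metric.ball (0 : EuclideanSpace ℝ (Fin d)) 1) :=
  ENNReal.ofReal_toReal measure_ball_lt_top.ne

/-- Even for `x` near the boundary, the ball of radius `r` contains a ball of radius `√t/2` whose
points lie within `√t` of `x`, where the kernel is of order `t^(-d/2)`. -/
theorem exists_le_heatSemigroup_indicator_ball (d : ℕ) :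
    ∃ c : ℝ, 0 < c ∧ ∀ (r t : ℝ) (x : EuclideanSpace ℝ (Fin d)), 0 < r → 0 < t → t ≤ r ^ 2 →
      x ∈ Metric.ball 0 r →
      ENNReal.ofReal c ≤ heatSemigroup t ((Metric.ball 0 r).indicator fun _ => 1) x := by
  have hω := volume_unitBall_toReal_pos d
  refine ⟨(4 * Real.pi) ^ (-((d : ℝ) / 2)) * Real.exp (-1 / 4) * (1 / 2) ^ d *
    (volume (Metric.ball (0 : EuclideanSpace ℝ (Fin d)) 1)).toReal, by positivity, ?_⟩
  intro r t x hr ht htr hx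
  have hst : 0 < √t := Real.sqrt_pos.2 ht
  have hsr : √t ≤ r := Real.sqrt_le_iff.2 ⟨hr.le, htr⟩
  have hxr : ‖x‖ < r := by simpa using hx
  -- Moving `x` towards the origin by the fraction `θ` shifts it by less than `θ r = √t/2`, and
  -- makes room for a ball of that radius.
  set θ : ℝ := √t / (2 * r) with hθ
  have hθ1 : θ ≤ 1 := by
    rw [hθ, div_le_one (by positivity)]
    linarith
  have hθr : θ * r = √t / 2 := by rw [hθ]; field_simp
  have hθ0 : 0 < θ := by positivity
  have hB : Metric.ball ((1 - θ) • x) (√t / 2) ⊆ Metric.ball 0 r := by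
    refine Metric.ball_subset_ball' ?_
    rw [dist_zero_right, norm_smul, Real.norm_of_nonneg (by linarith)]
    nlinarith
  have hR : ∀ y ∈ Metric.ball ((1 - θ) • x) (√t / 2), ‖x - y‖ ≤ √t := by
    intro y hy
    rw [Metric.mem_ball, dist_comm, dist_eq_norm] at hy
    have h1 : x - y = θ • x + ((1 - θ) • x - y) := by module
    rw [h1]
    refine (norm_add_le _ _).trans ?_
    rw [norm_smul, Real.norm_of_nonneg hθ0.le]
    nlinarith
  refine le_trans (le_of_eq ?_) (le_heatSemigroup_indicator ht (by positivity) hB hR)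
  rw [ENNReal.ofReal_mul (by positivity), ofReal_volume_unitBall]
  congr 2
  rw [Real.sq_sqrt ht.le, Real.mul_rpow (by positivity) ht.le, div_pow √t, one_div,
      inv_pow,
    show -t / (4 * t) = -1 / 4 by field_simp]
  have := rpow_neg_half_mul_sqrt_pow (d := d) ht
  calc _ = (4 * Real.pi) ^ (-((d : ℝ) / 2)) * Real.exp (-1 / 4) * (2 ^ d)⁻¹ *
        (t ^ (-((d : ℝ) / 2)) * √t ^ d) := by rw [this, mul_one]
    _ = _ := by ring

/-- All of the ball lies within `2√t` of `x`, so the Gaussian factor is at least `e⁻¹` there. -/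
theorem exists_mul_rpow_le_heatSemigroup_indicator_ball (d : ℕ) :
    ∃ c : ℝ, 0 < c ∧ ∀ (r t : ℝ) (x : EuclideanSpace ℝ (Fin d)), 0 < r → r ^ 2 ≤ t → ‖x‖ < √t →
      ENNReal.ofReal (c * r ^ d * t ^ (-((d : ℝ) / 2))) ≤
        heatSemigroup t ((Metric.ball 0 r).indicator fun _ => 1) x := by
  have hω := volume_unitBall_toReal_pos d
  refine ⟨(4 * Real.pi) ^ (-((d : ℝ) / 2)) * Real.exp (-1) *
    (volume (Metric.ball (0 : EuclideanSpace ℝ (Fin d)) 1)).toReal, by positivity, ?_⟩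
  intro r t x hr hrt hx
  have ht : 0 < t := lt_of_lt_of_le (by positivity) hrt
  have hrs : r ≤ √t := Real.le_sqrt_of_sq_le hrt
  refine le_trans (le_of_eq ?_) (le_heatSemigroup_indicator (z := 0) (ρ := r) (R := 2 * √t) ht
    hr subset_rfl fun y hy => ?_)
  · rw [mul_pow, Real.sq_sqrt ht.le, Real.mul_rpow (by positivity) ht.le,
      show -(2 ^ 2 * t) / (4 * t) = -1 by field_simp; norm_num]
    nth_rw 2 [← ofReal_volume_unitBall]
    rw [← ENNReal.ofReal_mul (by positivity)]
    congr 1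
    ring
  · have : ‖y‖ < r := by simpa using hy
    exact (norm_sub_le _ _).trans (by linarith)

/-! ### Lower bounds for solutions -/

theorem ae_ae_of_ae_restrict_univ_prod {d : ℕ} {T : ℝ} {P : EuclideanSpace ℝ (Fin d) × ℝ → Prop}
    (h : ∀ᵐ z ∂(volume.restrict (univ ×ˢ Ico 0 T)), P z) :
    ∀ᵐ t ∂(volume.restrict (Ioo 0 T)), ∀ᵐ x, P (x, t) := by
  rw [Measure.volume_eq_prod, ← Measure.prod_restrict, Measure.restrict_univ,
    Measure.restrict_congr_set Ioo_ae_eq_Ico.symm] at h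
  have h' := (Measure.measurePreserving_swap (μ := volume.restrict (Ioo 0 T))
    (ν := (volume : Measure (EuclideanSpace ℝ (Fin d))))).quasiMeasurePreserving.ae h
  exact Measure.ae_ae_of_ae_prod h'

theorem exists_mem_Ioo_of_ae_restrict {T : ℝ} {P : ℝ → Prop}
    (h : ∀ᵐ t ∂(volume.restrict (Ioo 0 T)), P t) {a b : ℝ} (ha : 0 ≤ a) (hab : a < b)
    (hb : b ≤ T) : ∃ t ∈ Ioo a b, P t := by
  have h' : ∀ᵐ t ∂(volume.restrict (Ioo a b)), P t :=
    ae_restrict_of_ae_restrict_of_subset (Ioo_subset_Ioo ha hb) h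
  have hne : NeBot (ae (volume.restrict (Ioo a b))) := by
    rw [ae_neBot, Ne, Measure.restrict_eq_zero, Real.volume_Ioo]
    simpa using hab
  obtain ⟨t, ht, hP⟩ := ((ae_restrict_mem measurableSet_Ioo).and h').exists
  exact ⟨t, ht, hP⟩

/-- A lower bound for the linear part of a solution yields one for the solution. -/
theorem IsLocalIntegralSolution.ae_le {d : ℕ} {f : ℝ≥0 → ℝ≥0} (hf : Monotone f)
    {u₀ : EuclideanSpace ℝ (Fin d) → ℝ} {T : ℝ} {u : EuclideanSpace ℝ (Fin d) × ℝ → ℝ≥0∞}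
    (hu : IsLocalIntegralSolution f u₀ T u) {a : EuclideanSpace ℝ (Fin d) × ℝ → ℝ≥0}
    (ha : ∀ x, ∀ t ∈ Ioo 0 T,
      (a (x, t) : ℝ≥0∞) ≤ heatSemigroup t (fun y => ENNReal.ofReal (u₀ y)) x) :
    ∀ᵐ t ∂(volume.restrict (Ioo 0 T)), ∀ᵐ x,
      ∫⁻ s in Ioo 0 t, heatSemigroup (t - s) (fun y => (f (a (y, s)) : ℝ≥0∞)) x ≤ u (x, t) := by
  have h1 := ae_ae_of_ae_restrict_univ_prod hu.eq_ae
  have h2 := ae_ae_of_ae_restrict_univ_prod hu.finite_ae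
  -- The solution dominates its linear part, hence `a`; this bound is inserted once into the Duhamel
  -- integral.
  have h3 : ∀ᵐ s ∂(volume.restrict (Ioo 0 T)), ∀ᵐ y,
      (f (a (y, s)) : ℝ≥0∞) ≤ f (u (y, s)).toNNReal := by
    filter_upwards [h1, h2, ae_restrict_mem measurableSet_Ioo] with s hs1 hs2 hs
    filter_upwards [hs1, hs2] with y hy1 hy2
    have hle : (a (y, s) : ℝ≥0∞) ≤ u (y, s) := by
      rw [hy1]
      exact (ha y s hs).trans le_self_add
    exact_mod_cast hf (ENNReal.le_toNNReal_of_coe_le hle hy2.ne)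
  filter_upwards [h1, ae_restrict_mem measurableSet_Ioo] with t ht1 ht
  filter_upwards [ht1] with x hx
  rw [hx]
  refine le_trans ?_ le_add_self
  have h4 := ae_restrict_of_ae_restrict_of_subset (Ioo_subset_Ioo_right ht.2.le) h3
  refine lintegral_mono_ae ?_
  filter_upwards [h4, ae_restrict_mem measurableSet_Ioo] with s hs hst
  exact heatSemigroup_mono_ae (sub_pos.2 hst.2) hs x

theorem mul_heatSemigroup_indicator_le {d : ℕ} {u₀ : EuclideanSpace ℝ (Fin d) → ℝ}
    {B : Set (EuclideanSpace ℝ (Fin d))} {s t : ℝ} (hs : ∀ᵐ y, y ∈ B → s ≤ u₀ y) (ht : 0 < t)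
    (x : EuclideanSpace ℝ (Fin d)) :
    ENNReal.ofReal s * heatSemigroup t (B.indicator fun _ => 1) x ≤
      heatSemigroup t (fun y => ENNReal.ofReal (u₀ y)) x := by
  rw [← heatSemigroup_const_mul _ ENNReal.ofReal_ne_top]
  refine heatSemigroup_mono_ae ht ?_ x
  filter_upwards [hs] with y hy
  by_cases hyB : y ∈ B
  · rw [indicator_of_mem hyB, mul_one]
    exact ENNReal.ofReal_le_ofReal (hy hyB)
  · rw [indicator_of_notMem hyB, mul_zero]
    exact zero_le

/-- Up to time `r²` the linear part is at least `c s` on the ball. The Duhamel source is then at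
least `f (c s)` there, and the heat flow again preserves the fraction `c`. -/
theorem mul_volume_rpow_le_essSup {d : ℕ} {f : ℝ≥0 → ℝ≥0} (hf : Monotone f) {q : ℝ} (hq : 0 < q)
    {c : ℝ} (hc : 0 < c)
    (hball : ∀ (r t : ℝ) (x : EuclideanSpace ℝ (Fin d)), 0 < r → 0 < t → t ≤ r ^ 2 →
      x ∈ Metric.ball 0 r →
      ENNReal.ofReal c ≤ heatSemigroup t ((Metric.ball 0 r).indicator fun _ => 1) x)
    {u₀ : EuclideanSpace ℝ (Fin d) → ℝ} {T : ℝ} {u : EuclideanSpace ℝ (Fin d) × ℝ → ℝ≥0∞}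
    (hu : IsLocalIntegralSolution f u₀ T u) {s r : ℝ} (hs : 0 < s) (hr : 0 < r)
    (hsr : ∀ᵐ y, y ∈ Metric.ball 0 r → s ≤ u₀ y) {τ : ℝ} (hτ : 0 < τ) (hτT : τ < T)
    (hτr : τ < r ^ 2) :
    ENNReal.ofReal (τ * c * f (c * s).toNNReal) *
        volume (Metric.ball (0 : EuclideanSpace ℝ (Fin d)) r) ^ (1 / q) ≤
      essSup (fun t => eLpNorm (fun x => u (x, t)) (ENNReal.ofReal q) volume)
        (volume.restrict (Ioo 0 T)) := by
  classical
  let a : EuclideanSpace ℝ (Fin d) × ℝ → ℝ≥0 := fun z =>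
    if z.1 ∈ Metric.ball 0 r ∧ z.2 ≤ r ^ 2 then (c * s).toNNReal else 0
  have ha : ∀ x, ∀ t ∈ Ioo 0 T,
      (a (x, t) : ℝ≥0∞) ≤ heatSemigroup t (fun y => ENNReal.ofReal (u₀ y)) x := by
    intro x t ht
    by_cases h : x ∈ Metric.ball 0 r ∧ t ≤ r ^ 2
    · simp only [a, if_pos h]
      refine le_trans ?_ (mul_heatSemigroup_indicator_le hsr ht.1 x)
      change ENNReal.ofReal _ ≤ _
      rw [mul_comm, ENNReal.ofReal_mul hs.le]
      gcongr
      exact hball r t x hr ht.1 h.2 h.1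
    · simp only [a, if_neg h, ENNReal.coe_zero]
      exact zero_le
  have hle := hu.ae_le hf ha
  have hess := ae_le_essSup (μ := volume.restrict (Ioo 0 T))
    (f := fun t => eLpNorm (fun x => u (x, t)) (ENNReal.ofReal q) volume)
  -- The bounds hold only for almost every time, so a good time is picked in `(τ, min T r²)`.
  obtain ⟨t, ht, h1, h2⟩ := exists_mem_Ioo_of_ae_restrict (hle.and hess) hτ.le
    (lt_min hτT hτr) (min_le_left _ _)
  have htr : t < r ^ 2 := ht.2.trans_le (min_le_right _ _)
  refine le_trans ?_ h2
  have h3 : ∀ᵐ x, x ∈ Metric.ball 0 r →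
      ENNReal.ofReal (τ * c * f (c * s).toNNReal) ≤ u (x, t) := by
    filter_upwards [h1] with x hx hxr
    refine le_trans ?_ hx
    calc ENNReal.ofReal (τ * c * f (c * s).toNNReal)
        ≤ ENNReal.ofReal (c * f (c * s).toNNReal) * ENNReal.ofReal t := by
          rw [← ENNReal.ofReal_mul (by positivity)]
          refine ENNReal.ofReal_le_ofReal ?_
          rw [mul_assoc, mul_comm]
          gcongr
          exact ht.1.le
      _ = ∫⁻ _ in Ioo 0 t, ENNReal.ofReal (c * f (c * s).toNNReal) := by
          rw [setLIntegral_const, Real.volume_Ioo, sub_zero]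
      _ ≤ _ := by
          refine setLIntegral_mono' measurableSet_Ioo fun σ hσ => ?_
          have h4 : ∀ y, (f (c * s).toNNReal : ℝ≥0∞) *
              (Metric.ball 0 r).indicator (fun _ => 1) y ≤ f (a (y, σ)) := by
            intro y
            by_cases hy : y ∈ Metric.ball 0 r
            · have : a (y, σ) = (c * s).toNNReal := if_pos ⟨hy, (hσ.2.trans htr).le⟩
              rw [this, indicator_of_mem hy, mul_one]
            · rw [indicator_of_notMem hy, mul_zero]
              exact zero_le
          refine le_trans ?_ (heatSemigroup_mono _ h4 x)
          rw [heatSemigroup_const_mul _ ENNReal.coe_ne_top, mul_comm c,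
            ENNReal.ofReal_mul (NNReal.coe_nonneg _), ENNReal.ofReal_coe_nnreal]
          gcongr
          exact hball r _ x hr (sub_pos.2 hσ.2) (by linarith [hσ.1]) hxr
  rw [eLpNorm_eq_lintegral_rpow_enorm_toReal (ENNReal.ofReal_pos.2 hq).ne'
    ENNReal.ofReal_ne_top, ENNReal.toReal_ofReal hq.le]
  set K : ℝ≥0∞ := ENNReal.ofReal (τ * c * f (c * s).toNNReal)
  calc K * volume (Metric.ball (0 : EuclideanSpace ℝ (Fin d)) r) ^ (1 / q)
      = (K ^ q * volume (Metric.ball (0 : EuclideanSpace ℝ (Fin d)) r)) ^ (1 / q) := by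
        rw [ENNReal.mul_rpow_of_nonneg _ _ (by positivity), ← ENNReal.rpow_mul,
          mul_one_div_cancel hq.ne', ENNReal.rpow_one]
    _ ≤ _ := by
        gcongr
        rw [← setLIntegral_const]
        refine le_trans ?_ (setLIntegral_le_lintegral (Metric.ball 0 r) _)
        refine setLIntegral_mono_ae' measurableSet_ball ?_
        filter_upwards [h3] with x hx hxr
        simp only [enorm_eq_self]
        gcongr
        exact hx hxr

/-- Superposition of multiples of indicator functions of balls. -/
theorem exists_memLp_forall_le {d : ℕ} {q : ℝ} (hq : 0 < q) {s r : ℕ → ℝ} (hs : ∀ k, 0 ≤ s k)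
    (hr : ∀ k, 0 < r k) (hsum : Summable fun k => s k ^ q * r k ^ d) :
    ∃ u₀ : EuclideanSpace ℝ (Fin d) → ℝ, MemLp u₀ (ENNReal.ofReal q) volume ∧
      0 ≤ᵐ[volume] u₀ ∧ ∀ k, ∀ᵐ y, y ∈ Metric.ball 0 (r k) → s k ≤ u₀ y := by
  -- Summing the `q`-th powers and taking a root at the end makes the `L^q` condition additive in
  -- `k`.
  let V : EuclideanSpace ℝ (Fin d) → ℝ≥0∞ := fun y =>
    ∑' k, (Metric.ball 0 (r k)).indicator (fun _ => ENNReal.ofReal (s k ^ q)) y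
  have hVk : ∀ k, Measurable ((Metric.ball (0 : EuclideanSpace ℝ (Fin d)) (r k)).indicator
      (fun _ => ENNReal.ofReal (s k ^ q))) := fun k => measurable_const.indicator measurableSet_ball
  have hV : Measurable V := Measurable.tsum hVk
  have hVint : ∫⁻ y, V y < ⊤ := by
    have h1 : ∀ k, ∫⁻ y, (Metric.ball (0 : EuclideanSpace ℝ (Fin d)) (r k)).indicator
        (fun _ => ENNReal.ofReal (s k ^ q)) y = ENNReal.ofReal (s k ^ q * r k ^ d) *
        volume (Metric.ball (0 : EuclideanSpace ℝ (Fin d)) 1) := by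
      intro k
      rw [lintegral_indicator_const measurableSet_ball, Measure.addHaar_ball_of_pos volume _ (hr k),
        finrank_euclideanSpace_fin, ENNReal.ofReal_mul (Real.rpow_nonneg (hs k) _), mul_assoc]
    rw [lintegral_tsum fun k => (hVk k).aemeasurable]
    simp_rw [h1]
    rw [ENNReal.tsum_mul_right, ← ENNReal.ofReal_tsum_of_nonneg (fun k => mul_nonneg
      (Real.rpow_nonneg (hs k) _) (pow_nonneg (hr k).le _)) hsum]
    exact ENNReal.mul_lt_top ENNReal.ofReal_lt_top measure_ball_lt_top
  refine ⟨fun y => (V y ^ (1 / q)).toReal, ⟨?_, ?_⟩, ?_, fun k => ?_⟩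
  · exact (hV.pow_const _).ennreal_toReal.aestronglyMeasurable
  · refine (eLpNorm_lt_top_iff_lintegral_rpow_enorm_lt_top (ENNReal.ofReal_pos.2 hq).ne'
      ENNReal.ofReal_ne_top).2 ?_
    rw [ENNReal.toReal_ofReal hq.le]
    refine lt_of_le_of_lt (lintegral_mono fun y => ?_) hVint
    rw [Real.enorm_eq_ofReal ENNReal.toReal_nonneg]
    calc ENNReal.ofReal (V y ^ (1 / q)).toReal ^ q ≤ (V y ^ (1 / q)) ^ q := by
          gcongr
          exact ENNReal.ofReal_toReal_le
      _ = V y := by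
          rw [← ENNReal.rpow_mul, one_div_mul_cancel hq.ne', ENNReal.rpow_one]
  · exact ae_of_all _ fun y => ENNReal.toReal_nonneg
  · filter_upwards [ae_lt_top hV hVint.ne] with y hy hyr
    have h1 : ENNReal.ofReal (s k ^ q) ≤ V y := by
      refine le_trans ?_ (ENNReal.le_tsum k)
      rw [indicator_of_mem hyr]
    rw [← ENNReal.ofReal_le_iff_le_toReal
      (ENNReal.rpow_lt_top_of_nonneg (by positivity) hy.ne).ne, one_div,
      ENNReal.le_rpow_inv_iff hq, ENNReal.ofReal_rpow_of_nonneg (hs k) hq.le]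
    exact h1

/-! ### Necessity of the pointwise growth conditions -/

theorem HasLocalExistenceProperty.exists_bound_of_summable {d : ℕ} {f : ℝ≥0 → ℝ≥0}
    (hf : Monotone f) {q : ℝ} (hq : 0 < q) (h : HasLocalExistenceProperty d f (ENNReal.ofReal q))
    {c : ℝ} (hc : 0 < c)
    (hball : ∀ (r t : ℝ) (x : EuclideanSpace ℝ (Fin d)), 0 < r → 0 < t → t ≤ r ^ 2 →
      x ∈ Metric.ball 0 r →
      ENNReal.ofReal c ≤ heatSemigroup t ((Metric.ball 0 r).indicator fun _ => 1) x)
    {s r : ℕ → ℝ} (hs : ∀ k, 0 < s k) (hr : ∀ k, 0 < r k)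
    (hsum : Summable fun k => s k ^ q * r k ^ d) :
    ∃ T M : ℝ, 0 < T ∧ ∀ k τ, 0 < τ → τ < T → τ < r k ^ 2 →
      τ * f (c * s k).toNNReal * r k ^ ((d : ℝ) / q) ≤ M := by
  obtain ⟨u₀, hu₀, hpos, hle⟩ := exists_memLp_forall_le hq (fun k => (hs k).le) hr hsum
  obtain ⟨u, T, hT, hu, hess⟩ := h u₀ hu₀ hpos
  set E := essSup (fun t => eLpNorm (fun x => u (x, t)) (ENNReal.ofReal q) volume)
    (volume.restrict (Ioo 0 T))
  set ω : ℝ := (volume (Metric.ball (0 : EuclideanSpace ℝ (Fin d)) 1)).toReal with hω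
  have hω0 : 0 < ω := volume_unitBall_toReal_pos d
  refine ⟨T, E.toReal / (c * ω ^ (1 / q)), hT, fun k τ hτ hτT hτr => ?_⟩
  have h1 := mul_volume_rpow_le_essSup hf hq hc hball hu (hs k) (hr k) (hle k) hτ hτT hτr
  have hrk := hr k
  rw [Measure.addHaar_ball_of_pos volume _ (hr k), finrank_euclideanSpace_fin,
    ← ofReal_volume_unitBall, ← ENNReal.ofReal_mul (by positivity),
    ENNReal.ofReal_rpow_of_nonneg (by positivity) (by positivity),
    ← ENNReal.ofReal_mul (by positivity), ENNReal.ofReal_le_iff_le_toReal hess.ne,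
    Real.mul_rpow (by positivity) (by positivity), ← Real.rpow_natCast, ← Real.rpow_mul hrk.le,
    mul_one_div] at h1
  rw [le_div_iff₀ (by positivity)]
  refine le_trans (le_of_eq ?_) h1
  ring

/-- The radii `r_k = (2^(-k)/s_k)^(q/d)` make `s_k^q r_k^d = 2^(-kq)`, which is summable, and leave
the heights free. -/
theorem HasLocalExistenceProperty.exists_bound {d : ℕ} (hd : 0 < d) {f : ℝ≥0 → ℝ≥0}
    (hf : Monotone f) {q : ℝ} (hq : 1 ≤ q) (h : HasLocalExistenceProperty d f (ENNReal.ofReal q))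
    {c : ℝ} (hc : 0 < c)
    (hball : ∀ (r t : ℝ) (x : EuclideanSpace ℝ (Fin d)), 0 < r → 0 < t → t ≤ r ^ 2 →
      x ∈ Metric.ball 0 r →
      ENNReal.ofReal c ≤ heatSemigroup t ((Metric.ball 0 r).indicator fun _ => 1) x)
    {s : ℕ → ℝ} (hs : ∀ k, 0 < s k) :
    ∃ T M : ℝ, 0 < T ∧ ∀ k τ, 0 < τ → τ < T → τ < ((1 / 2) ^ k / s k) ^ (2 * q / d) →
      τ * f (c * s k).toNNReal * ((1 / 2) ^ k / s k) ≤ M := by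
  have hq0 : 0 < q := by linarith
  have hd0 : (0 : ℝ) < d := by exact_mod_cast hd
  have hx : ∀ k, 0 < (1 / 2 : ℝ) ^ k / s k := fun k => by have := hs k; positivity
  obtain ⟨T, M, hT, hM⟩ := h.exists_bound_of_summable hf hq0 hc hball hs
    (r := fun k => ((1 / 2) ^ k / s k) ^ (q / d)) (fun k => Real.rpow_pos_of_pos (hx k) _) (by
      refine Summable.of_nonneg_of_le (fun k => by have := hs k; have := hx k; positivity)
        (fun k => ?_) (summable_geometric_of_lt_one (r := 1 / 2) (by norm_num) (by norm_num))
      have hsk := hs k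
      rw [← Real.rpow_natCast _ d, ← Real.rpow_mul (hx k).le, div_mul_cancel₀ _ hd0.ne',
        Real.div_rpow (by positivity) hsk.le, mul_div_cancel₀ _ (by positivity)]
      exact Real.rpow_le_self_of_le_one (by positivity)
        (pow_le_one₀ (by norm_num) (by norm_num)) hq)
  refine ⟨T, M, hT, fun k τ hτ hτT hτx => ?_⟩
  have h1 := hM k τ hτ hτT (by
    rw [← Real.rpow_natCast _ 2, ← Real.rpow_mul (hx k).le]
    refine hτx.trans_eq ?_
    congr 1
    push_cast
    ring)
  rwa [← Real.rpow_mul (hx k).le, div_mul_div_cancel₀ hd0.ne', div_self hq0.ne',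
    Real.rpow_one] at h1

theorem exists_lt_mul_two_pow {a : ℝ} (ha : 0 < a) (M : ℝ) (N : ℕ) :
    ∃ k, N ≤ k ∧ M < a * 2 ^ k := by
  have h := (tendsto_pow_atTop_atTop_of_one_lt (one_lt_two (α := ℝ))).const_mul_atTop ha
  obtain ⟨k, hk, hNk⟩ := ((h.eventually_gt_atTop M).and (eventually_ge_atTop N)).exists
  exact ⟨k, hNk, hk⟩

/-- Heights `s_k ≤ 2^(-k)` give radii at least 1, so one fixed `τ < 1` serves all `k`; with `f (c
s_k) ≥ 4^k c s_k` the bounded quantity is at least `τ c 2^k`. -/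
theorem HasLocalExistenceProperty.limsup_div_lt_top {d : ℕ} (hd : 0 < d) {f : ℝ≥0 → ℝ≥0}
    (hf : Monotone f) {q : ℝ} (hq : 1 ≤ q)
    (h : HasLocalExistenceProperty d f (ENNReal.ofReal q)) :
    limsup (fun s : ℝ≥0 => (f s : ℝ≥0∞) / (s : ℝ≥0∞)) (𝓝[>] 0) < ⊤ := by
  by_contra htop
  rw [not_lt, top_le_iff] at htop
  obtain ⟨c, hc, hball⟩ := exists_le_heatSemigroup_indicator_ball d
  have hq0 : 0 < q := by linarith
  have hd0 : (0 : ℝ) < d := by exact_mod_cast hd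
  have hσ : ∀ k : ℕ, ∃ s : ℝ, 0 < s ∧ s ≤ (1 / 2) ^ k ∧
      4 ^ k * (c * s) ≤ f (c * s).toNNReal := by
    intro k
    have h1 : ((4 ^ k : ℝ≥0) : ℝ≥0∞) <
        limsup (fun s : ℝ≥0 => (f s : ℝ≥0∞) / (s : ℝ≥0∞)) (𝓝[>] 0) := by
      rw [htop]
      exact ENNReal.coe_lt_top
    have hb : (0 : ℝ≥0) < (c * (1 / 2) ^ k).toNNReal := by
      rw [Real.toNNReal_pos]
      positivity
    obtain ⟨σ, hσ, hσ0, hσb⟩ := ((frequently_lt_of_lt_limsup (by isBoundedDefault) h1).and_eventually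
      (Ioo_mem_nhdsGT hb)).exists
    have hσ0' : (0 : ℝ) < σ := by exact_mod_cast hσ0
    have hcs : c * (σ / c) = σ := by field_simp
    refine ⟨σ / c, by positivity, ?_, ?_⟩
    · rw [div_le_iff₀ hc, mul_comm]
      have h2 : (σ : ℝ) < (c * (1 / 2) ^ k).toNNReal := by exact_mod_cast hσb
      rw [Real.coe_toNNReal _ (by positivity)] at h2
      exact h2.le
    · rw [hcs, Real.toNNReal_coe]
      have h3 := (ENNReal.le_div_iff_mul_le (Or.inl (by exact_mod_cast hσ0.ne'))
        (Or.inl ENNReal.coe_ne_top)).1 hσ.le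
      exact_mod_cast h3
  choose s hs0 hs1 hs2 using hσ
  obtain ⟨T, M, hT, hM⟩ := h.exists_bound hd hf hq hc hball hs0
  obtain ⟨τ, hτ0, hτ⟩ := exists_between (lt_min hT one_pos)
  obtain ⟨k, -, hk⟩ := exists_lt_mul_two_pow (mul_pos hτ0 hc) M 0
  have hsk := hs0 k
  have h1 : 1 ≤ (1 / 2) ^ k / s k := (one_le_div hsk).2 (hs1 k)
  have h2 := hM k τ hτ0 (hτ.trans_le (min_le_left _ _))
    ((hτ.trans_le (min_le_right _ _)).trans_le (Real.one_le_rpow h1 (by positivity)))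
  have h3 : τ * c * 2 ^ k ≤ τ * f (c * s k).toNNReal * ((1 / 2) ^ k / s k) := by
    calc τ * c * 2 ^ k = τ * (4 ^ k * (c * s k)) * ((1 / 2) ^ k / s k) := by
          rw [show (4 : ℝ) = 2 * 2 by norm_num, mul_pow, one_div, inv_pow]
          field_simp
      _ ≤ _ := by
          gcongr
          exact hs2 k
  linarith

theorem HasLocalExistenceProperty.limsup_rpow_mul_lt_top {d : ℕ} (hd : 0 < d) {f : ℝ≥0 → ℝ≥0}
    (hf : Monotone f) {q : ℝ} (hq : 1 ≤ q)
    (h : HasLocalExistenceProperty d f (ENNReal.ofReal q)) :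
    limsup (fun s : ℝ≥0 => ((s ^ (-(1 + 2 * q / (d : ℝ))) * f s : ℝ≥0) : ℝ≥0∞)) atTop < ⊤ := by
  by_contra htop
  rw [not_lt, top_le_iff] at htop
  obtain ⟨c, hc, hball⟩ := exists_le_heatSemigroup_indicator_ball d
  have hq0 : 0 < q := by linarith
  have hd0 : (0 : ℝ) < d := by exact_mod_cast hd
  set e : ℝ := 2 * q / d with he
  have he0 : 0 < e := by positivity
  have hσ : ∀ k : ℕ, ∃ s : ℝ, 1 ≤ s ∧
      2 ^ k * ((1 / 2) ^ k) ^ (-(1 + e)) * (c * s) ^ (1 + e) ≤ f (c * s).toNNReal := by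
    intro k
    have h1 : ((2 ^ k * ((1 / 2) ^ k) ^ (-(1 + e)) : ℝ≥0) : ℝ≥0∞) <
        limsup (fun s : ℝ≥0 => ((s ^ (-(1 + e)) * f s : ℝ≥0) : ℝ≥0∞)) atTop := by
      rw [htop]
      exact ENNReal.coe_lt_top
    obtain ⟨σ, hσ, hσc⟩ := ((frequently_lt_of_lt_limsup (by isBoundedDefault) h1).and_eventually
      (eventually_ge_atTop c.toNNReal)).exists
    have hσc' : c ≤ σ := Real.toNNReal_le_iff_le_coe.1 hσc
    have hσ0 : (0 : ℝ) < σ := hc.trans_le hσc'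
    have hcs : c * (σ / c) = σ := by field_simp
    refine ⟨σ / c, (one_le_div hc).2 hσc', ?_⟩
    rw [hcs, Real.toNNReal_coe]
    have h2 : (2 ^ k * ((1 / 2) ^ k) ^ (-(1 + e)) : ℝ) ≤ (σ : ℝ) ^ (-(1 + e)) * f σ := by
      exact_mod_cast hσ.le
    calc 2 ^ k * ((1 / 2) ^ k) ^ (-(1 + e)) * (σ : ℝ) ^ (1 + e)
        ≤ (σ : ℝ) ^ (-(1 + e)) * f σ * (σ : ℝ) ^ (1 + e) := by gcongr
      _ = f σ := by
        rw [Real.rpow_neg hσ0.le]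
        field_simp
  choose s hs1 hs2 using hσ
  have hs0 : ∀ k, 0 < s k := fun k => one_pos.trans_le (hs1 k)
  obtain ⟨T, M, hT, hM⟩ := h.exists_bound hd hf hq hc hball hs0
  have htend : Tendsto (fun k : ℕ => ((1 / 2 : ℝ) ^ k) ^ e) atTop (𝓝 0) := by
    have h1 := tendsto_pow_atTop_nhds_zero_of_lt_one (r := (1 / 2 : ℝ)) (by norm_num) (by norm_num)
    simpa [Real.zero_rpow he0.ne'] using h1.rpow_const (p := e) (Or.inr he0.le)
  obtain ⟨N, hN⟩ := eventually_atTop.1 (htend.eventually (gt_mem_nhds hT))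
  obtain ⟨k, hNk, hk⟩ := exists_lt_mul_two_pow
    (show 0 < 1 / 2 * c ^ (1 + e) by positivity) M N
  have hsk := hs0 k
  set x : ℝ := (1 / 2) ^ k / s k with hx
  have hx0 : 0 < x := by positivity
  have hxT : x ^ e < T := by
    refine lt_of_le_of_lt (Real.rpow_le_rpow hx0.le ?_ he0.le) (hN k hNk)
    exact div_le_self (by positivity) (hs1 k)
  have hxe : 0 < x ^ e := Real.rpow_pos_of_pos hx0 _
  -- The time is half the parabolic limit `r_k² = x^e`; since `x ≤ 2^(-k)`, it is also below `T` for
  -- large `k`.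
  have h2 := hM k (1 / 2 * x ^ e) (by positivity) (by linarith) (by linarith)
  have h3 : 1 / 2 * c ^ (1 + e) * 2 ^ k ≤ 1 / 2 * x ^ e * f (c * s k).toNNReal * x := by
    calc 1 / 2 * c ^ (1 + e) * 2 ^ k
        = 1 / 2 * x ^ e * (2 ^ k * ((1 / 2) ^ k) ^ (-(1 + e)) * (c * s k) ^ (1 + e)) * x := by
          have h4 : (1 / 2 : ℝ) ^ k = x * s k := by rw [hx]; field_simp
          have h5 : x ^ (1 + e) = x * x ^ e := by rw [Real.rpow_add hx0, Real.rpow_one]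
          rw [h4, Real.rpow_neg (by positivity), Real.mul_rpow hx0.le hsk.le,
            Real.mul_rpow hc.le hsk.le, h5]
          field_simp
      _ ≤ _ := by
          gcongr
          exact hs2 k
  linarith

/-! ### Necessity of the integral condition for `q = 1` -/

theorem lintegral_rpow_Ioi {a c : ℝ} (ha : a < -1) (hc : 0 < c) :
    ∫⁻ s in Ioi c, ENNReal.ofReal (s ^ a) = ENNReal.ofReal (-c ^ (a + 1) / (a + 1)) := by
  rw [← integral_Ioi_rpow_of_lt ha hc, ofReal_integral_eq_lintegral_ofReal
    (integrableOn_Ioi_rpow_of_lt ha hc)]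
  filter_upwards [ae_restrict_mem measurableSet_Ioi] with s hs
  exact Real.rpow_nonneg (hc.trans hs).le _

/-- By monotonicity, `f t / t ≤ 4 ∫ f(σ) σ⁻² dσ` over `(t, 2t)`. This replaces the supremum over `t
∈ (N, s]` by an integral over `(N, 2s)`. -/
theorem supQuotient_le_add_lintegral {f : ℝ≥0 → ℝ≥0} (hf : Monotone f) {N : ℝ} (hN : 0 < N)
    (s : ℝ) :
    supQuotient f s.toNNReal ≤ supQuotient f N.toNNReal +
      4 * ∫⁻ σ in Ioi N, (Iio (2 * s)).indicator
        (fun σ => (f σ.toNNReal : ℝ≥0∞) * ENNReal.ofReal (σ ^ (-2 : ℝ))) σ := by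
  refine iSup₂_le fun t ht => ?_
  have ht0 : (0 : ℝ) < t := by exact_mod_cast ht.1
  rcases le_or_gt t N.toNNReal with htN | htN
  · exact le_add_right (le_iSup₂_of_le t ⟨ht.1, htN⟩ le_rfl)
  · refine le_add_left ?_
    have htN' : N < t := (Real.toNNReal_lt_iff_lt_coe hN.le).1 htN
    have hts : (t : ℝ) ≤ s := by
      by_contra hlt
      have h0 : 0 < s.toNNReal := ht.1.trans_le ht.2
      exact hlt ((Real.le_toNNReal_iff_coe_le (Real.toNNReal_pos.1 h0).le).1 ht.2)
    have h1 : ENNReal.ofReal (1 / (4 * t)) * f t ≤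
        ∫⁻ σ in Ioi N, (Iio (2 * s)).indicator
          (fun σ => (f σ.toNNReal : ℝ≥0∞) * ENNReal.ofReal (σ ^ (-2 : ℝ))) σ := by
      calc ENNReal.ofReal (1 / (4 * t)) * f t
          = ∫⁻ _ in Ioo (t : ℝ) (2 * t), f t * ENNReal.ofReal ((2 * t) ^ (-2 : ℝ)) := by
            rw [setLIntegral_const, Real.volume_Ioo, mul_assoc,
              ← ENNReal.ofReal_mul (by positivity), mul_comm]
            congr 2
            rw [Real.rpow_neg (by positivity), Real.rpow_two]
            field_simp
            ring
        _ ≤ ∫⁻ σ in Ioo (t : ℝ) (2 * t), (Iio (2 * s)).indicator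
              (fun σ => (f σ.toNNReal : ℝ≥0∞) * ENNReal.ofReal (σ ^ (-2 : ℝ))) σ := by
            refine setLIntegral_mono' measurableSet_Ioo fun σ hσ => ?_
            rw [indicator_of_mem (show σ ∈ Iio (2 * s) from hσ.2.trans_le (by linarith))]
            gcongr ?_ * ENNReal.ofReal ?_
            · exact_mod_cast hf (NNReal.le_toNNReal_of_coe_le hσ.1.le)
            · exact Real.rpow_le_rpow_of_nonpos (ht0.trans hσ.1) hσ.2.le (by norm_num)
        _ ≤ _ := lintegral_mono_set fun σ hσ => htN'.trans hσ.1
    refine le_trans (le_of_eq ?_) (mul_le_mul_right h1 4)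
    rw [← mul_assoc, ← ENNReal.ofReal_ofNat 4, ← ENNReal.ofReal_mul (by norm_num), mul_comm,
      div_eq_mul_inv]
    congr 1
    rw [← ENNReal.ofReal_coe_nnreal, ← ENNReal.ofReal_inv_of_pos ht0]
    congr 1
    field_simp

/-- A Hardy-type inequality: `F` is integrable against `s^{-(1+e)}` as soon as `f(s)/s` is. -/
theorem lintegral_supQuotient_lt_top {f : ℝ≥0 → ℝ≥0} (hf : Monotone f)
    (hF : ∀ s, supQuotient f s < ⊤) {e N : ℝ} (he : 0 < e) (hN : 0 < N)
    (hint : ∫⁻ σ in Ioi N, (f σ.toNNReal : ℝ≥0∞) * ENNReal.ofReal (σ ^ (-(2 + e))) < ⊤) :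
    ∫⁻ s in Ioi (1 : ℝ), ENNReal.ofReal (s ^ (-(1 + e))) * supQuotient f s.toNNReal < ⊤ := by
  set k : ℝ → ℝ≥0∞ := fun σ => (f σ.toNNReal : ℝ≥0∞) * ENNReal.ofReal (σ ^ (-2 : ℝ)) with hk
  have hfm : Measurable fun σ : ℝ => (f σ.toNNReal : ℝ≥0∞) :=
    (hf.measurable.comp measurable_real_toNNReal).coe_nnreal_ennreal
  have hkm : Measurable k := hfm.mul (by fun_prop)
  have hpow : Measurable fun s : ℝ => ENNReal.ofReal (s ^ (-(1 + e))) := by fun_prop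
  have hS : MeasurableSet {p : ℝ × ℝ | p.2 < 2 * p.1} :=
    measurableSet_lt measurable_snd (measurable_fst.const_mul 2)
  have hjoint : Measurable fun p : ℝ × ℝ =>
      ENNReal.ofReal (p.1 ^ (-(1 + e))) * (Iio (2 * p.1)).indicator k p.2 := by
    refine (hpow.comp measurable_fst).mul ?_
    have := (hkm.comp measurable_snd).indicator hS
    convert! this using 2
  have h1 : ∫⁻ s in Ioi (1 : ℝ), ENNReal.ofReal (s ^ (-(1 + e))) * supQuotient f s.toNNReal ≤
      ∫⁻ s in Ioi (1 : ℝ), (supQuotient f N.toNNReal * ENNReal.ofReal (s ^ (-(1 + e))) +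
        4 * ∫⁻ σ in Ioi N, ENNReal.ofReal (s ^ (-(1 + e))) *
          (Iio (2 * s)).indicator k σ) := by
    refine lintegral_mono fun s => ?_
    dsimp only
    rw [lintegral_const_mul' _ _ ENNReal.ofReal_ne_top]
    calc _ ≤ ENNReal.ofReal (s ^ (-(1 + e))) * (supQuotient f N.toNNReal +
          4 * ∫⁻ σ in Ioi N, (Iio (2 * s)).indicator k σ) := by
          gcongr
          exact supQuotient_le_add_lintegral hf hN s
      _ = _ := by ring
  -- After Tonelli, the constraint `σ < 2s` leaves `∫ s^(-(1+e)) ds` over `s > σ/2`, which equals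
  -- `(σ/2)^(-e)/e`.
  have hinner : ∀ σ ∈ Ioi N, ∫⁻ s in Ioi (1 : ℝ), ENNReal.ofReal (s ^ (-(1 + e))) *
      (Iio (2 * s)).indicator k σ ≤
      ENNReal.ofReal ((1 / 2) ^ (-e) / e) *
        ((f σ.toNNReal : ℝ≥0∞) * ENNReal.ofReal (σ ^ (-(2 + e)))) := by
    intro σ hσ
    have hσ0 : 0 < σ := hN.trans hσ
    calc _ ≤ ∫⁻ s, (Ioi (σ / 2)).indicator (fun s => ENNReal.ofReal (s ^ (-(1 + e))) * k σ) s := by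
          refine (setLIntegral_le_lintegral _ _).trans (lintegral_mono fun s => ?_)
          by_cases h : σ < 2 * s
          · rw [indicator_of_mem (show σ ∈ Iio (2 * s) from h),
              indicator_of_mem (show s ∈ Ioi (σ / 2) by rw [mem_Ioi]; linarith)]
          · rw [indicator_of_notMem (show σ ∉ Iio (2 * s) from h), mul_zero]
            exact zero_le
      _ = ENNReal.ofReal (-(σ / 2) ^ (-(1 + e) + 1) / (-(1 + e) + 1)) * k σ := by
          rw [lintegral_indicator measurableSet_Ioi, lintegral_mul_const _ hpow,
            lintegral_rpow_Ioi (by linarith) (by positivity)]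
      _ = _ := by
          rw [hk, mul_left_comm, mul_left_comm (ENNReal.ofReal ((1 / 2) ^ (-e) / e))]
          congr 1
          rw [← ENNReal.ofReal_mul' (by positivity), ← ENNReal.ofReal_mul (by positivity)]
          congr 1
          rw [show -(1 + e) + 1 = -e by ring, neg_div_neg_eq, div_eq_mul_one_div σ 2,
            Real.mul_rpow hσ0.le (by norm_num), show -(2 + e) = -e + -2 by ring,
            Real.rpow_add hσ0]
          ring
  refine h1.trans_lt ?_
  rw [lintegral_add_left (hpow.const_mul _), lintegral_const_mul _ hpow,
    lintegral_rpow_Ioi (by linarith) one_pos, lintegral_const_mul' _ _ (by norm_num),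
    lintegral_lintegral_swap hjoint.aemeasurable]
  refine ENNReal.add_lt_top.2 ⟨ENNReal.mul_lt_top (hF _) ENNReal.ofReal_lt_top,
    ENNReal.mul_lt_top (by norm_num) ?_⟩
  refine (setLIntegral_mono' measurableSet_Ioi hinner).trans_lt ?_
  rw [lintegral_const_mul' _ _ ENNReal.ofReal_ne_top]
  exact ENNReal.mul_lt_top ENNReal.ofReal_lt_top hint

/-- The substitution `σ = A s^(-α)` turns this integral into that of `f(σ) σ^(-(2+1/α))` near
infinity, to which the Hardy-type inequality applies. Divergence holds for every `A > 0`, so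
arbitrarily small masses can be used. -/
theorem lintegral_comp_mul_rpow_neg_eq_top {f : ℝ≥0 → ℝ≥0} (hf : Monotone f)
    (hF : ∀ s, supQuotient f s < ⊤) {α A τ : ℝ} (hα : 0 < α) (hA : 0 < A) (hτ : 0 < τ)
    (hint : ∫⁻ s in Ioi (1 : ℝ),
      ENNReal.ofReal (s ^ (-(1 + 1 / α))) * supQuotient f s.toNNReal = ⊤) :
    ∫⁻ s in Ioo 0 τ, (f (A * s ^ (-α)).toNNReal : ℝ≥0∞) * ENNReal.ofReal (s ^ α) = ⊤ := by
  by_contra hne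
  refine (lintegral_supQuotient_lt_top hf hF (one_div_pos.2 hα)
    (show 0 < A * τ ^ (-α) by positivity) ?_).ne hint
  have h := lintegral_comp_mul_rpow_neg hα hA hτ
    (fun σ => (f σ.toNNReal : ℝ≥0∞) * ENNReal.ofReal (σ⁻¹))
  have h1 : ∫⁻ s in Ioo 0 τ, (f (A * s ^ (-α)).toNNReal : ℝ≥0∞) *
      ENNReal.ofReal ((A * s ^ (-α))⁻¹) = ENNReal.ofReal A⁻¹ *
      ∫⁻ s in Ioo 0 τ, (f (A * s ^ (-α)).toNNReal : ℝ≥0∞) * ENNReal.ofReal (s ^ α) := by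
    rw [← lintegral_const_mul' _ _ ENNReal.ofReal_ne_top]
    refine setLIntegral_congr_fun measurableSet_Ioo fun s hs => ?_
    rw [mul_inv, Real.rpow_neg hs.1.le, inv_inv, ENNReal.ofReal_mul (by positivity)]
    ring
  have h2 : ∫⁻ σ in Ioi (A * τ ^ (-α)), (f σ.toNNReal : ℝ≥0∞) *
      ENNReal.ofReal (σ ^ (-(2 + 1 / α))) =
      ∫⁻ σ in Ioi (A * τ ^ (-α)), ENNReal.ofReal (σ ^ (-(1 + 1 / α))) *
        ((f σ.toNNReal : ℝ≥0∞) * ENNReal.ofReal (σ⁻¹)) := by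
    refine setLIntegral_congr_fun measurableSet_Ioi fun σ hσ => ?_
    have hσ0 : 0 < σ := lt_trans (by positivity) hσ
    rw [mul_left_comm, ← ENNReal.ofReal_mul (by positivity), ← Real.rpow_neg_one σ,
      ← Real.rpow_add hσ0]
    congr 3
    ring
  rw [h2, h, h1]
  exact ENNReal.mul_lt_top ENNReal.ofReal_lt_top
    (ENNReal.mul_lt_top ENNReal.ofReal_lt_top (Ne.lt_top hne))

theorem lintegral_mul_volume_le_essSup {d : ℕ} {f : ℝ≥0 → ℝ≥0} (hf : Monotone f)
    {c : ℝ}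
    (hball : ∀ (r t : ℝ) (x : EuclideanSpace ℝ (Fin d)), 0 < r → r ^ 2 ≤ t → ‖x‖ < √t →
      ENNReal.ofReal (c * r ^ d * t ^ (-((d : ℝ) / 2))) ≤
        heatSemigroup t ((Metric.ball 0 r).indicator fun _ => 1) x)
    {u₀ : EuclideanSpace ℝ (Fin d) → ℝ} {T : ℝ} {u : EuclideanSpace ℝ (Fin d) × ℝ → ℝ≥0∞}
    (hu : IsLocalIntegralSolution f u₀ T u) {s r : ℝ} (hs : 0 < s) (hr : 0 < r)
    (hsr : ∀ᵐ y, y ∈ Metric.ball 0 r → s ≤ u₀ y) {τ : ℝ} (hτ : 0 < τ) (hτT : τ < T) :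
    (∫⁻ σ in Ioo (r ^ 2) τ, (f (c * (s * r ^ d) * σ ^ (-((d : ℝ) / 2))).toNNReal : ℝ≥0∞) *
        ENNReal.ofReal (σ ^ ((d : ℝ) / 2))) *
        volume (Metric.ball (0 : EuclideanSpace ℝ (Fin d)) 1) ≤
      essSup (fun t => eLpNorm (fun x => u (x, t)) 1 volume) (volume.restrict (Ioo 0 T)) := by
  set b : ℝ → ℝ≥0 := fun σ => (c * (s * r ^ d) * σ ^ (-((d : ℝ) / 2))).toNNReal with hb
  have hbm : Measurable b := by fun_prop
  -- The parabolic region filled by the bump once `σ ≥ r²`; its time slice is a ball of volume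
  -- proportional to `σ^(d/2)`.
  let S : Set (EuclideanSpace ℝ (Fin d) × ℝ) := {z | r ^ 2 ≤ z.2 ∧ ‖z.1‖ < √z.2}
  have hS : MeasurableSet S :=
    (measurableSet_le measurable_const measurable_snd).inter
      (measurableSet_lt measurable_fst.norm measurable_snd.sqrt)
  let a : EuclideanSpace ℝ (Fin d) × ℝ → ℝ≥0 := S.indicator fun z => b z.2
  have ham : Measurable a := (hbm.comp measurable_snd).indicator hS
  have ha : ∀ x, ∀ t ∈ Ioo 0 T,
      (a (x, t) : ℝ≥0∞) ≤ heatSemigroup t (fun y => ENNReal.ofReal (u₀ y)) x := by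
    intro x t ht
    by_cases h : (x, t) ∈ S
    · simp only [a, indicator_of_mem h]
      refine le_trans ?_ (mul_heatSemigroup_indicator_le hsr ht.1 x)
      change ENNReal.ofReal _ ≤ _
      rw [show c * (s * r ^ d) * t ^ (-((d : ℝ) / 2)) =
        s * (c * r ^ d * t ^ (-((d : ℝ) / 2))) by ring, ENNReal.ofReal_mul hs.le]
      gcongr
      exact hball r t x hr h.1 h.2
    · simp only [a, indicator_of_notMem h, ENNReal.coe_zero]
      exact zero_le
  have hle := hu.ae_le hf ha
  have hess := ae_le_essSup (μ := volume.restrict (Ioo 0 T))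
    (f := fun t => eLpNorm (fun x => u (x, t)) 1 volume)
  obtain ⟨t, ht, h1, h2⟩ := exists_mem_Ioo_of_ae_restrict (hle.and hess) hτ.le hτT le_rfl
  refine le_trans ?_ h2
  rw [eLpNorm_one_eq_lintegral_enorm]
  simp only [enorm_eq_self]
  refine le_trans ?_ (lintegral_mono_ae h1)
  have hfa : Measurable fun z => (f (a z) : ℝ≥0∞) :=
    (hf.measurable.comp ham).coe_nnreal_ennreal
  have hmeas : Measurable fun p : EuclideanSpace ℝ (Fin d) × ℝ =>
      heatSemigroup (t - p.2) (fun y => (f (a (y, p.2)) : ℝ≥0∞)) p.1 :=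
    measurable_heatSemigroup (α := EuclideanSpace ℝ (Fin d) × ℝ) (τ := fun p => t - p.2)
      (ξ := fun p => p.1) (g := fun p y => (f (a (y, p.2)) : ℝ≥0∞))
      (by fun_prop) (by fun_prop) (hfa.comp (by fun_prop))
  rw [lintegral_lintegral_swap hmeas.aemeasurable,
    ← lintegral_mul_const' _ _ measure_ball_lt_top.ne]
  refine (setLIntegral_mono' measurableSet_Ioo fun σ hσ => ?_).trans
    (lintegral_mono_set (Ioo_subset_Ioo (sq_nonneg r) ht.1.le))
  have hσ0 : 0 < σ := lt_trans (by positivity) hσ.1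
  have hpow : √σ ^ d = σ ^ ((d : ℝ) / 2) := by
    rw [Real.sqrt_eq_rpow, ← Real.rpow_natCast, ← Real.rpow_mul hσ0.le]
    congr 1
    ring
  have hvol : ENNReal.ofReal (σ ^ ((d : ℝ) / 2)) *
      volume (Metric.ball (0 : EuclideanSpace ℝ (Fin d)) 1) =
      volume (Metric.ball (0 : EuclideanSpace ℝ (Fin d)) √σ) := by
    rw [Measure.addHaar_ball_of_pos volume 0 (Real.sqrt_pos.2 hσ0), finrank_euclideanSpace_fin,
      hpow]
  have hfσ : Measurable fun y => (f (a (y, σ)) : ℝ≥0∞) := hfa.comp measurable_prodMk_right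
  -- Conservation of mass: the source produced at time `σ` is counted in full at time `t`.
  rw [lintegral_heatSemigroup (sub_pos.2 (hσ.2.trans ht.1)) hfσ, mul_assoc, hvol,
    ← setLIntegral_const]
  refine (setLIntegral_mono' measurableSet_ball fun y hy => ?_).trans
    (setLIntegral_le_lintegral (Metric.ball 0 √σ) _)
  have hyS : (y, σ) ∈ S := ⟨hσ.1.le, by simpa using hy⟩
  have hay : a (y, σ) = b σ := indicator_of_mem hyS _
  rw [hay]

theorem exists_le_setLIntegral_Ioo_sq {g : ℝ → ℝ≥0∞} {τ : ℝ}
    (hg : ∫⁻ s in Ioo 0 τ, g s = ⊤) (K : ℕ) : ∃ r : ℝ, 0 < r ∧ K ≤ ∫⁻ s in Ioo (r ^ 2) τ, g s := by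
  by_contra! h
  have hU : Ioo 0 τ = ⋃ n : ℕ, Ioo ((1 / ((n : ℝ) + 1)) ^ 2) τ := by
    ext s
    simp only [mem_iUnion, mem_Ioo]
    constructor
    · rintro ⟨h0, h1⟩
      obtain ⟨n, hn⟩ := exists_nat_one_div_lt (Real.sqrt_pos.2 h0)
      exact ⟨n, (Real.lt_sqrt (by positivity)).1 hn, h1⟩
    · rintro ⟨n, hn, h1⟩
      exact ⟨lt_trans (by positivity) hn, h1⟩
  have hmono : Monotone fun n : ℕ => Ioo ((1 / ((n : ℝ) + 1)) ^ 2) τ := by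
    intro m n hmn
    refine Ioo_subset_Ioo_left ?_
    have : (m : ℝ) ≤ n := by exact_mod_cast hmn
    gcongr
  rw [hU, setLIntegral_iUnion_of_directed _ hmono.directed_le] at hg
  have hle : ⨆ n : ℕ, ∫⁻ s in Ioo ((1 / ((n : ℝ) + 1)) ^ 2) τ, g s ≤ K :=
    iSup_le fun n => (h _ (by positivity)).le
  rw [hg] at hle
  exact (ENNReal.natCast_ne_top K) (top_le_iff.1 hle)

theorem HasLocalExistenceProperty.lintegral_supQuotient_lt_top {d : ℕ} (hd : 0 < d)
    {f : ℝ≥0 → ℝ≥0} (hf : Monotone f) (h : HasLocalExistenceProperty d f 1)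
    (h0 : limsup (fun s : ℝ≥0 => (f s : ℝ≥0∞) / (s : ℝ≥0∞)) (𝓝[>] 0) < ⊤) :
    ∫⁻ s in Ioi (1 : ℝ),
      ENNReal.ofReal (s ^ (-(1 + 2 / (d : ℝ)))) * supQuotient f s.toNNReal < ⊤ := by
  by_contra htop
  rw [not_lt, top_le_iff] at htop
  have hd0 : (0 : ℝ) < d := by exact_mod_cast hd
  obtain ⟨c, hc, hball⟩ := exists_mul_rpow_le_heatSemigroup_indicator_ball d
  -- The `k`-th bump has mass `2^(-k)` and is concentrated enough to produce at least `k` before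
  -- time `1/(k+1)`. The shrinking end time is needed because the existence time `T` is known only
  -- after the data are fixed.
  have hdiv : ∀ k : ℕ, ∃ r : ℝ, 0 < r ∧ (k : ℝ≥0∞) ≤ ∫⁻ σ in Ioo (r ^ 2) (1 / ((k : ℝ) + 1)),
      (f (c * (1 / 2) ^ k * σ ^ (-((d : ℝ) / 2))).toNNReal : ℝ≥0∞) *
        ENNReal.ofReal (σ ^ ((d : ℝ) / 2)) := fun k =>
    exists_le_setLIntegral_Ioo_sq (lintegral_comp_mul_rpow_neg_eq_top hf
      (supQuotient_lt_top hf h0) (by positivity) (by positivity) (by positivity)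
      (by rwa [one_div_div])) k
  choose r hr hrk using hdiv
  have hsr : ∀ k, (1 / 2) ^ k / r k ^ d * r k ^ d = (1 / 2) ^ k := fun k =>
    div_mul_cancel₀ _ (pow_pos (hr k) d).ne'
  have hs : ∀ k, 0 < (1 / 2) ^ k / r k ^ d := fun k => by have := hr k; positivity
  obtain ⟨u₀, hu₀, hpos, hle⟩ := exists_memLp_forall_le (d := d) one_pos (fun k => (hs k).le) hr
    (by simpa only [Real.rpow_one, hsr] using summable_geometric_two)
  rw [ENNReal.ofReal_one] at hu₀
  obtain ⟨u, T, hT, hu, hess⟩ := h u₀ hu₀ hpos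
  set E := essSup (fun t => eLpNorm (fun x => u (x, t)) 1 volume) (volume.restrict (Ioo 0 T))
  set ω := volume (Metric.ball (0 : EuclideanSpace ℝ (Fin d)) 1)
  have hω : ω ≠ 0 := (Metric.measure_ball_pos _ _ one_pos).ne'
  obtain ⟨n, hn⟩ := exists_nat_one_div_lt hT
  obtain ⟨m, hm⟩ := ENNReal.exists_nat_gt (ENNReal.div_lt_top hess.ne hω).ne
  set k := max n m
  have hkT : 1 / ((k : ℝ) + 1) < T := by
    refine lt_of_le_of_lt ?_ hn
    have : (n : ℝ) ≤ k := by exact_mod_cast le_max_left n m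
    gcongr
  have h1 := lintegral_mul_volume_le_essSup hf hball hu (hs k) (hr k) (hle k)
    (by positivity) hkT
  rw [hsr] at h1
  have h2 : (k : ℝ≥0∞) * ω ≤ E := (mul_le_mul_left (hrk k) ω).trans h1
  have h3 : (k : ℝ≥0∞) ≤ E / ω :=
    (ENNReal.le_div_iff_mul_le (Or.inl hω) (Or.inl measure_ball_lt_top.ne)).2 h2
  have h4 : (m : ℝ≥0∞) ≤ k := by exact_mod_cast le_max_right n m
  exact absurd (hm.trans_le (h4.trans h3)) (lt_irrefl _)

theorem theorem5p1 (d : ℕ) (hd : 0 < d) (f : ℝ≥0 → ℝ≥0) (hf_cont : Continuous f)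
    (hf_mono : Monotone f) :
    (∀ q : ℝ, 1 < q →
      (HasLocalExistenceProperty d f (ENNReal.ofReal q) ↔
        limsup (fun s : ℝ≥0 => (f s : ℝ≥0∞) / (s : ℝ≥0∞)) (𝓝[>] 0) < ⊤ ∧
        limsup (fun s : ℝ≥0 => ((s ^ (-(1 + 2 * q / (d : ℝ))) * f s : ℝ≥0) : ℝ≥0∞)) atTop < ⊤)) ∧
    (HasLocalExistenceProperty d f 1 ↔
      limsup (fun s : ℝ≥0 => (f s : ℝ≥0∞) / (s : ℝ≥0∞)) (𝓝[>] 0) < ⊤ ∧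
      (∫⁻ s in Ioi (1 : ℝ),
        ENNReal.ofReal (s ^ (-(1 + 2 / (d : ℝ)))) * supQuotient f s.toNNReal) < ⊤) := by
  refine ⟨fun q hq => ⟨fun h => ⟨h.limsup_div_lt_top hd hf_mono hq.le,
    h.limsup_rpow_mul_lt_top hd hf_mono hq.le⟩, fun h => ?_⟩, fun h => ?_, fun h =>
    hasLocalExistenceProperty_one hd hf_cont hf_mono h.1 h.2⟩
  · obtain ⟨C, hC⟩ := exists_le_mul_add_rpow hf_mono h.1 h.2
    exact hasLocalExistenceProperty_of_le_add_rpow hd hf_cont hf_mono hq hC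
  · have h0 := HasLocalExistenceProperty.limsup_div_lt_top hd hf_mono le_rfl
      (ENNReal.ofReal_one ▸ h)
    exact ⟨h0, h.lintegral_supQuotient_lt_top hd hf_mono h0⟩
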